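/- **Setting.** A hypothesis is a function $h:\mathbb N\to\{0,1\}$, a hypothesis class is a set of hypotheses, and a notion of learnability is a property $L$ of hypothesis classes. Let $\mathcal S=\bigcup_n(\mathbb N\times\{0,1\})^n$ be the set of samples, and for a probability distribution $\mathcal D$ on $\mathbb N\times\{0,1\}$ let $L_{\mathcal D}(h)=\Pr_{(x,y)\sim\mathcal D}[h(x)\ne y]$. A class $\mathcal H$ is *PAC learnable* if there are $m_{\mathcal H}:(0,1)^2\to\mathbb N$ and $A:\mathcal S\to\mathcal H$ such that for all $\epsilon,\delta\in(0,1)$, all $m\ge m_{\mathcal H}(\epsilon,\delta)$ and all $\mathcal D$, $$\Pr_{S\sim\mathcal D^m}\bigl[L_{\mathcal D}(A(S))\le\inf_{h\in\mathcal H}L_{\mathcal D}(h)+\epsilon\bigr]\ge 1-\delta .$$ It is *SCPAC learnable* if there are a computable $m_{\mathcal H}:\mathbb N^2\to\mathbb N$ and an $A:\mathcal S\to\mathcal H$, for which a program for $A(S)$ is computable from $S$, such that for all $a,b\ge1$, all $m\ge m_{\mathcal H}(a,b)$ and all $\mathcal D$, $$\Pr_{S\sim\mathcal D^m}\bigl[L_{\mathcal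 D}(A(S))>\inf_{h\in\mathcal H}L_{\mathcal D}(h)+1/a\bigr]<1/b .$$ Let $\varphi_i$ and $W_i=\operatorname{dom}\varphi_i$ be the standard enumerations of the partial computable functions and the c.e. sets. An index $e$ *represents* the class $\{\varphi_k:k\in W_e\}$ if $\varphi_k$ is a hypothesis (total and $\{0,1\}$-valued) for every $k\in W_e$. A *computable family* is a sequence $(\mathcal H_i)_{i\in\mathbb N}$ of hypothesis classes for which there is a computable $r$ such that $r(i)$ represents $\mathcal H_i$ for every $i$. It is *maximal* if there is a uniformly computable sequence $(h_k)_{k\in\mathbb N}$ of hypotheses with $\mathcal H_i=\{h_k:k\in W_i\}$ for all $i$. The learnability decision problem of the family is to decide, given $i$, whether $\mathcal H_i$ has $L$; it is *unsolvable* if $\{i:L(\mathcal H_i)\}$ is not computable. A formula $\psi(x)$ of first-order arithmetic in one free variable *characterizes* $L$ if, for every $e$ that represents a class $\mathcal H$, $\mathbb N\models\psi(e)$ if and only if $L(\mathcal H)$; the notion $L$ is *arithmetically characterizable* if there is such a $\psi$. A procedure $i\mapsto Y_i$ *expresses the learnability* of the classes of a family if it is computable, every $Y_i$ is a sentence of first-order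 arithmetic, and $\mathbb N\models Y_i$ if and only if $L(\mathcal H_i)$. An arithmetical sentence is proved, or refuted, by ZFC if ZFC proves, or refutes, its standard rendering in set theory (quantifiers ranging over $\omega$), and it is *independent of ZFC* if it is neither proved nor refuted. ZFC is *arithmetically sound* if every arithmetical sentence that it proves is true in $\mathbb N$. **Proposition 4.2.** 1. PAC learnability and SCPAC learnability are arithmetically characterizable. 2. Every maximal computable family is a computable family. 3. Let $L$ be a notion of learnability characterized by the arithmetical formula $\psi$, and let $(\mathcal H_i)_{i\in\mathbb N}$ be a computable family with a computable $r$ such that $r(i)$ represents $\mathcal H_i$ for every $i$. Then: (a) the procedure $i\mapsto\psi(r(i))$ expresses the learnability of the $\mathcal H_i$; (b) if the family is maximal and nontrivial (some $\mathcal H_i$ has $L$ and some $\mathcal H_j$ does not), then its learnability decision problem is unsolvable; (c) if ZFC is arithmetically sound and the learnability decision problem of the family is unsolvable, then for infinitely many $i$ the learnability of $\mathcal H_i$ is independent of ZFC: for every procedure $i\mapsto Y_i$ that expresses the learnability of the $\mathcal H_i$ (in particular $Y_i=\psi(r(i))$), the sentence $Y_i$ is independent of ZFC for infinitely many $i$.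 -/

import Mathlib

open MeasureTheory

/-! ## Hypotheses, samples, PAC learnability -/

/-- Hypotheses: functions from the domain `ℕ` to the label space `{0, 1}`. -/
abbrev Hypothesis : Type := ℕ → Bool

/-- Samples: finite ordered sequences of input-label pairs. -/
abbrev Sample : Type := List (ℕ × Bool)

/-- The true error of `h` with respect to a distribution `D` on `ℕ × {0, 1}`. -/
noncomputable def risk (D : Measure (ℕ × Bool)) (h : Hypothesis) : ℝ :=
  D.real {p | h p.1 ≠ p.2}

/-- The optimal risk in the class `H` (as an infimum, which need not be attained). -/
noncomputable def bestRisk (D : Measure (ℕ × Bool)) (H : Set Hypothesis) : ℝ :=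
  ⨅ h : H, risk D h

/-- The probability, over an i.i.d. sample `S` of size `m` from `D`, of the event `E`. -/
noncomputable def sampleProb (D : Measure (ℕ × Bool)) (m : ℕ) (E : Set Sample) : ℝ :=
  (Measure.pi (fun _ : Fin m => D)).real {S | List.ofFn S ∈ E}

/-- (Proper, agnostic) PAC learnability. -/
def PACLearnable (H : Set Hypothesis) : Prop :=
  ∃ (mH : Set.Ioo (0 : ℝ) 1 → Set.Ioo (0 : ℝ) 1 → ℕ) (A : Sample → Hypothesis),
    (∀ S, A S ∈ H) ∧
    ∀ (ε δ : Set.Ioo (0 : ℝ) 1) (m : ℕ), mH ε δ ≤ m →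
      ∀ D : Measure (ℕ × Bool), IsProbabilityMeasure D →
        1 - (δ : ℝ) ≤ sampleProb D m {S | risk D (A S) ≤ bestRisk D H + ε}

/-! ## Computability -/

/-- The standard enumeration of the partial computable functions. -/
def phi (i : ℕ) : ℕ →. ℕ := (Denumerable.ofNat Nat.Partrec.Code i).eval

/-- The standard enumeration of the computably enumerable sets. -/
def W (i : ℕ) : Set ℕ := {n | (phi i n).Dom}

/-- The program with index `k` computes the (total) hypothesis `h`. -/
def Computes (k : ℕ) (h : Hypothesis) : Prop := ∀ x, phi k x = Part.some (h x).toNat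

/-- `A` is a learning algorithm: a total computable procedure that on each sample outputs a
program for a computable hypothesis. -/
def IsLearningAlgorithm (A : Sample → Hypothesis) : Prop :=
  ∃ a : Sample → ℕ, Computable a ∧ ∀ S, Computes (a S) (A S)

/-- (Proper, agnostic) strong computable PAC learnability: PAC learnability by a computable learner
with a computable sample complexity. -/
def SCPACLearnable (H : Set Hypothesis) : Prop :=
  ∃ (mH : ℕ → ℕ → ℕ) (A : Sample → Hypothesis),
    Computable₂ mH ∧ IsLearningAlgorithm A ∧ (∀ S, A S ∈ H) ∧
    ∀ a b : ℕ, 1 ≤ a → 1 ≤ b → ∀ m : ℕ, mH a b ≤ m →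
      ∀ D : Measure (ℕ × Bool), IsProbabilityMeasure D →
        sampleProb D m {S | bestRisk D H + 1 / (a : ℝ) < risk D (A S)} < 1 / (b : ℝ)

/-! ## Computable families of hypothesis classes -/

/-- `e` is an effective representation of a recursively enumerably representable hypothesis class:
an instruction for enumerating programs, all of which compute hypotheses. -/
def IsRERIndex (e : ℕ) : Prop := ∀ k ∈ W e, ∃ h : Hypothesis, Computes k h

/-- The class of hypotheses computed by the programs enumerated by `e`. -/
def hypClass (e : ℕ) : Set Hypothesis := {h | ∃ k ∈ W e, Computes k h}

/-- `r` is a computable procedure that for each `i` retrieves an effective representation of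
the class `H i`. -/
def RepresentsFamily (r : ℕ → ℕ) (H : ℕ → Set Hypothesis) : Prop :=
  Computable r ∧ ∀ i, IsRERIndex (r i) ∧ H i = hypClass (r i)

/-- Computable families of hypothesis classes. -/
def IsComputableFamily (H : ℕ → Set Hypothesis) : Prop := ∃ r, RepresentsFamily r H

/-- Maximal computable families: those that consist, in the order of the standard enumeration of
the c.e. sets, of all c.e. subclasses of a base class `{C 0, C 1, …}` of computable hypotheses
given by a computable decoding function `C`. -/
def IsMaximalFamily (H : ℕ → Set Hypothesis) : Prop :=
  ∃ C : ℕ → Hypothesis, Computable₂ C ∧ ∀ i, H i = C '' W i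

/-- The decision problem of `L`-learnability for the family `H` is solvable. -/
def LearnabilitySolvable (L : Set Hypothesis → Prop) (H : ℕ → Set Hypothesis) : Prop :=
  ComputablePred fun i => L (H i)

/-! ## First-order arithmetic

Variables are de Bruijn indices: variable `0` is bound by the innermost quantifier. -/

/-- Terms of the language `0, S, +, ·` of first-order arithmetic. -/
inductive ArithTerm : Type
  | var (n : ℕ)
  | zero
  | succ (t : ArithTerm)
  | add (s t : ArithTerm)
  | mul (s t : ArithTerm)

/-- Formulas of first-order arithmetic. -/
inductive ArithFormula : Type
  | eq (s t : ArithTerm)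
  | bot
  | imp (φ ψ : ArithFormula)
  | all (φ : ArithFormula)

namespace ArithTerm

/-- The value of a term in the standard model `ℕ`. -/
def eval (v : ℕ → ℕ) : ArithTerm → ℕ
  | var n => v n
  | zero => 0
  | succ t => t.eval v + 1
  | add s t => s.eval v + t.eval v
  | mul s t => s.eval v * t.eval v

/-- All variables of the term are smaller than `k`. -/
def FreeBelow (k : ℕ) : ArithTerm → Prop
  | var n => n < k
  | zero => True
  | succ t => t.FreeBelow k
  | add s t => s.FreeBelow k ∧ t.FreeBelow k
  | mul s t => s.FreeBelow k ∧ t.FreeBelow k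

/-- The numeral `S ⋯ S 0` of `n`. -/
def numeral : ℕ → ArithTerm
  | 0 => zero
  | n + 1 => succ (numeral n)

/-- Replace variable `k` by the numeral of `n`. -/
def substNumeral (n k : ℕ) : ArithTerm → ArithTerm
  | var j => if j = k then numeral n else var j
  | zero => zero
  | succ t => succ (t.substNumeral n k)
  | add s t => add (s.substNumeral n k) (t.substNumeral n k)
  | mul s t => mul (s.substNumeral n k) (t.substNumeral n k)

/-- Gödel numbers of terms. -/
def code : ArithTerm → ℕ
  | var n => Nat.pair 0 n
  | zero => Nat.pair 1 0
  | succ t => Nat.pair 2 t.code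
  | add s t => Nat.pair 3 (Nat.pair s.code t.code)
  | mul s t => Nat.pair 4 (Nat.pair s.code t.code)

end ArithTerm

namespace ArithFormula

/-- Satisfaction in the standard model `ℕ` under the assignment `v`. -/
def Holds : ArithFormula → (ℕ → ℕ) → Prop
  | eq s t, v => s.eval v = t.eval v
  | bot, _ => False
  | imp φ ψ, v => φ.Holds v → ψ.Holds v
  | all φ, v => ∀ a : ℕ, φ.Holds (fun | 0 => a | n + 1 => v n)

/-- All free variables of the formula are smaller than `k`. -/
def FreeBelow : ℕ → ArithFormula → Prop
  | k, eq s t => s.FreeBelow k ∧ t.FreeBelow k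
  | _, bot => True
  | k, imp φ ψ => φ.FreeBelow k ∧ ψ.FreeBelow k
  | k, all φ => φ.FreeBelow (k + 1)

/-- Sentences: formulas without free variables. -/
def IsSentence (φ : ArithFormula) : Prop := φ.FreeBelow 0

/-- Truth in the standard model (meant for sentences). -/
def IsTrue (φ : ArithFormula) : Prop := ∀ v, φ.Holds v

/-- Replace the free variable `k` by the numeral of `n`. -/
def substNumeral (n : ℕ) : ℕ → ArithFormula → ArithFormula
  | k, eq s t => eq (s.substNumeral n k) (t.substNumeral n k)
  | _, bot => bot
  | k, imp φ ψ => imp (φ.substNumeral n k) (ψ.substNumeral n k)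
  | k, all φ => all (φ.substNumeral n (k + 1))

/-- The instance `ψ(n)` of a formula `ψ` in the one free variable `0`. -/
def atNumeral (ψ : ArithFormula) (n : ℕ) : ArithFormula := ψ.substNumeral n 0

/-- Gödel numbers of formulas. -/
def code : ArithFormula → ℕ
  | eq s t => Nat.pair 0 (Nat.pair s.code t.code)
  | bot => Nat.pair 1 0
  | imp φ ψ => Nat.pair 2 (Nat.pair φ.code ψ.code)
  | all φ => Nat.pair 3 φ.code

end ArithFormula

/-! ## Set theory -/

/-- Formulas of the first-order language with `∈` and `=`, again with de Bruijn indices. -/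
inductive SetFormula : Type
  | mem (x y : ℕ)
  | eq (x y : ℕ)
  | bot
  | imp (φ ψ : SetFormula)
  | all (φ : SetFormula)

namespace SetFormula

/-- Negation. -/
def neg (φ : SetFormula) : SetFormula := imp φ bot

/-- Conjunction. -/
def conj (φ ψ : SetFormula) : SetFormula := neg (imp φ (neg ψ))

/-- Disjunction. -/
def disj (φ ψ : SetFormula) : SetFormula := imp (neg φ) ψ

/-- Biconditional. -/
def biimp (φ ψ : SetFormula) : SetFormula := conj (imp φ ψ) (imp ψ φ)

/-- Existential quantification. -/
def ex (φ : SetFormula) : SetFormula := neg (all (neg φ))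

/-- The extension of a renaming of variables to the scope of a quantifier. -/
def up (ρ : ℕ → ℕ) : ℕ → ℕ
  | 0 => 0
  | n + 1 => ρ n + 1

/-- Capture-avoiding renaming of the free variables. -/
def rename : (ℕ → ℕ) → SetFormula → SetFormula
  | ρ, mem x y => mem (ρ x) (ρ y)
  | ρ, eq x y => eq (ρ x) (ρ y)
  | _, bot => bot
  | ρ, imp φ ψ => imp (φ.rename ρ) (ψ.rename ρ)
  | ρ, all φ => all (φ.rename (up ρ))

/-- Make room for a new variable `0`. -/
def shift (φ : SetFormula) : SetFormula := φ.rename Nat.succ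

/-- Given the scope `φ` of a quantifier, put the variable `t` for the bound variable. -/
def inst (φ : SetFormula) (t : ℕ) : SetFormula :=
  φ.rename (fun | 0 => t | n + 1 => n)

/-- `x = ∅` -/
def isEmpty (x : ℕ) : SetFormula := all (neg (mem 0 (x + 1)))

/-- `s = x ∪ {x}` -/
def isSucc (s x : ℕ) : SetFormula :=
  all (biimp (mem 0 (s + 1)) (disj (mem 0 (x + 1)) (eq 0 (x + 1))))

/-- `p = {a, b}` -/
def isPair (p a b : ℕ) : SetFormula :=
  all (biimp (mem 0 (p + 1)) (disj (eq 0 (a + 1)) (eq 0 (b + 1))))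

/-- `p` is the ordered pair `(a, b) = {{a}, {a, b}}`. -/
def isOrdPair (p a b : ℕ) : SetFormula :=
  ex (ex (conj (isPair 1 (a + 2) (a + 2))
    (conj (isPair 0 (a + 2) (b + 2)) (isPair (p + 2) 1 0))))

/-- `(a, b) ∈ f` -/
def pairMem (a b f : ℕ) : SetFormula := ex (conj (isOrdPair 0 (a + 1) (b + 1)) (mem 0 (f + 1)))

/-- `x` contains `∅` and is closed under `y ↦ y ∪ {y}`. -/
def isInductive (x : ℕ) : SetFormula :=
  conj (ex (conj (isEmpty 0) (mem 0 (x + 1))))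
    (all (imp (mem 0 (x + 1)) (ex (conj (isSucc 0 1) (mem 0 (x + 2))))))

/-- `x ∈ ω`: the set `x` belongs to all inductive sets. -/
def isNat (x : ℕ) : SetFormula := all (imp (isInductive 0) (mem (x + 1) 0))

/-- `z = x + y`, for `x, y, z ∈ ω`: the pair `(y, z)` belongs to all sets that contain `(0, x)` and
contain `(n + 1, m + 1)` whenever they contain `(n, m)`. -/
def isSum (z x y : ℕ) : SetFormula :=
  all (imp
    (conj
      (ex (conj (isEmpty 0) (pairMem 0 (x + 2) 1)))
      (all (all (imp (pairMem 1 0 2)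
        (ex (ex (conj (isSucc 1 3) (conj (isSucc 0 2) (pairMem 1 0 4)))))))))
    (pairMem (y + 1) (z + 1) 0))

/-- `z = x · y`, for `x, y, z ∈ ω`: the pair `(y, z)` belongs to all sets that contain `(0, 0)` and
contain `(n + 1, m + x)` whenever they contain `(n, m)` with `m ∈ ω`. -/
def isProd (z x y : ℕ) : SetFormula :=
  all (imp
    (conj
      (ex (conj (isEmpty 0) (pairMem 0 0 1)))
      (all (all (imp (conj (isNat 0) (pairMem 1 0 2))
        (ex (ex (conj (isSucc 1 3)
          (conj (isNat 0) (conj (isSum 0 2 (x + 5)) (pairMem 1 0 4))))))))))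
    (pairMem (y + 1) (z + 1) 0))

end SetFormula

/-- The formula stating that the set variable `z` is the value of the arithmetical term `t`, where
the arithmetical variable `n` is read as the set variable `n + k`. -/
def ArithTerm.graph : ArithTerm → (k z : ℕ) → SetFormula
  | .var n, k, z => .eq z (n + k)
  | .zero, _, z => .isEmpty z
  | .succ t, k, z => .ex (.conj (t.graph (k + 1) 0) (.isSucc (z + 1) 0))
  | .add s t, k, z =>
      .ex (.ex (.conj (s.graph (k + 2) 1) (.conj (t.graph (k + 2) 0) (.isSum (z + 2) 1 0))))
  | .mul s t, k, z =>
      .ex (.ex (.conj (s.graph (k + 2) 1) (.conj (t.graph (k + 2) 0) (.isProd (z + 2) 1 0))))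

/-- The standard rendering of an arithmetical formula in the language of set theory: quantifiers
range over `ω`, and `0, S, +, ·` are read as the usual operations on `ω`. -/
def ArithFormula.toSet : ArithFormula → SetFormula
  | .eq s t => .ex (.conj (s.graph 1 0) (t.graph 1 0))
  | .bot => .bot
  | .imp φ ψ => .imp φ.toSet ψ.toSet
  | .all φ => .all (.imp (.isNat 0) φ.toSet)

open SetFormula in
/-- The axioms of Zermelo-Fraenkel set theory with choice. Free variables (the parameters in the
two schemes) are understood to be universally quantified. -/
inductive ZFC : SetFormula → Prop
  /-- `∀ x y, (∀ z, z ∈ x ↔ z ∈ y) → x = y` -/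
  | extensionality : ZFC (all (all (imp (all (biimp (mem 0 2) (mem 0 1))) (eq 1 0))))
  /-- `∀ x, (∃ y, y ∈ x) → ∃ y, y ∈ x ∧ ¬ ∃ z, z ∈ y ∧ z ∈ x` -/
  | foundation : ZFC (all (imp (ex (mem 0 1))
      (ex (conj (mem 0 1) (neg (ex (conj (mem 0 1) (mem 0 2))))))))
  /-- `∀ x y, ∃ p, p = {x, y}` -/
  | pairing : ZFC (all (all (ex (isPair 0 2 1))))
  /-- `∀ x, ∃ u, ∀ z, z ∈ u ↔ ∃ y, y ∈ x ∧ z ∈ y` -/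
  | union : ZFC (all (ex (all (biimp (mem 0 1) (ex (conj (mem 0 3) (mem 1 0)))))))
  /-- `∀ x, ∃ p, ∀ z, z ∈ p ↔ ∀ w, w ∈ z → w ∈ x` -/
  | powerset : ZFC (all (ex (all (biimp (mem 0 1) (all (imp (mem 0 1) (mem 0 3)))))))
  /-- There is an inductive set. -/
  | infinity : ZFC (ex (isInductive 0))
  /-- `∀ x, ∃ y, ∀ z, z ∈ y ↔ z ∈ x ∧ φ(z)`, where in `φ` the variable `z` is `0`, and the other
  variables are parameters -/
  | separation (φ : SetFormula) : ZFC (all (ex (all (biimp (mem 0 1) (conj (mem 0 2)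
      (φ.rename (fun | 0 => 0 | n + 1 => n + 3)))))))
  /-- `∀ x, (∀ z ∈ x, ∀ w w', φ(z, w) ∧ φ(z, w') → w = w') →
  ∃ y, ∀ w, w ∈ y ↔ ∃ z, z ∈ x ∧ φ(z, w)`, where in `φ` the variable `z` is `0`, the variable `w`
  is `1`, and the other variables are parameters -/
  | replacement (φ : SetFormula) : ZFC (all (imp
      (all (imp (mem 0 1) (all (all (imp
        (conj (φ.rename (fun | 0 => 2 | 1 => 1 | n + 2 => n + 4))
          (φ.rename (fun | 0 => 2 | 1 => 0 | n + 2 => n + 4)))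
        (eq 1 0))))))
      (ex (all (biimp (mem 0 1) (ex (conj (mem 0 3)
        (φ.rename (fun | 0 => 0 | 1 => 1 | n + 2 => n + 4)))))))))
  /-- Every set `x` of nonempty, pairwise disjoint sets has a choice set `c`:
  `∀ x, (∀ y ∈ x, ∃ z, z ∈ y) ∧ (∀ y ∈ x, ∀ z ∈ x, (∃ w, w ∈ y ∧ w ∈ z) → y = z) →
  ∃ c, ∀ y ∈ x, ∃ z, z ∈ y ∧ z ∈ c ∧ ∀ w, w ∈ y ∧ w ∈ c → w = z` -/
  | choice : ZFC (all (imp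
      (conj
        (all (imp (mem 0 1) (ex (mem 0 1))))
        (all (imp (mem 0 1) (all (imp (mem 0 2)
          (imp (ex (conj (mem 0 2) (mem 0 1))) (eq 1 0)))))))
      (ex (all (imp (mem 0 2) (ex (conj (mem 0 1) (conj (mem 0 2)
        (all (imp (conj (mem 0 2) (mem 0 3)) (eq 0 1)))))))))))

/-- Derivability of `φ` from the assumptions `Γ` and the axioms of ZFC, in classical natural
deduction with equality. -/
inductive ZFCDerives : List SetFormula → SetFormula → Prop
  | ofZFC {Γ : List SetFormula} {φ : SetFormula} : ZFC φ → ZFCDerives Γ φ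
  | assumption {Γ : List SetFormula} {φ : SetFormula} : φ ∈ Γ → ZFCDerives Γ φ
  | impIntro {Γ : List SetFormula} {φ ψ : SetFormula} :
      ZFCDerives (φ :: Γ) ψ → ZFCDerives Γ (.imp φ ψ)
  | impElim {Γ : List SetFormula} {φ ψ : SetFormula} :
      ZFCDerives Γ (.imp φ ψ) → ZFCDerives Γ φ → ZFCDerives Γ ψ
  | byContradiction {Γ : List SetFormula} {φ : SetFormula} :
      ZFCDerives (φ.neg :: Γ) .bot → ZFCDerives Γ φ
  | allIntro {Γ : List SetFormula} {φ : SetFormula} :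
      ZFCDerives (Γ.map SetFormula.shift) φ → ZFCDerives Γ (.all φ)
  | allElim {Γ : List SetFormula} {φ : SetFormula} (t : ℕ) :
      ZFCDerives Γ (.all φ) → ZFCDerives Γ (φ.inst t)
  | eqRefl {Γ : List SetFormula} (t : ℕ) : ZFCDerives Γ (.eq t t)
  | eqSubst {Γ : List SetFormula} {φ : SetFormula} {s t : ℕ} :
      ZFCDerives Γ (.eq s t) → ZFCDerives Γ (φ.inst s) → ZFCDerives Γ (φ.inst t)

/-- `ZFC ⊢ φ` -/
def ZFCProves (φ : SetFormula) : Prop := ZFCDerives [] φ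

/-- ZFC is arithmetically sound: the arithmetical sentences that it proves are true in `ℕ`. -/
def ZFCArithmeticallySound : Prop :=
  ∀ σ : ArithFormula, σ.IsSentence → ZFCProves σ.toSet → σ.IsTrue

/-- ZFC neither proves nor refutes the arithmetical sentence `σ`. -/
def IndependentOfZFC (σ : ArithFormula) : Prop :=
  ¬ ZFCProves σ.toSet ∧ ¬ ZFCProves σ.toSet.neg

/-! ## Arithmetical characterizations of learnability -/

/-- The arithmetical formula `ψ` in one free variable characterizes the notion of learnability `L`:
for each effective representation `e` of a hypothesis class, `ψ(e)` says that the class is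
learnable. -/
def Characterizes (ψ : ArithFormula) (L : Set Hypothesis → Prop) : Prop :=
  ψ.FreeBelow 1 ∧ ∀ e, IsRERIndex e → ((ψ.atNumeral e).IsTrue ↔ L (hypClass e))

/-- The notion of learnability `L` can be arithmetically characterized. -/
def ArithmeticallyCharacterizable (L : Set Hypothesis → Prop) : Prop := ∃ ψ, Characterizes ψ L

/-- `Y` is a computable procedure that for each `i` returns a sentence of first-order arithmetic
which expresses that the class `H i` is learnable. -/
def ExpressesLearnability (L : Set Hypothesis → Prop) (H : ℕ → Set Hypothesis)
    (Y : ℕ → ArithFormula) : Prop :=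
  Computable (fun i => (Y i).code) ∧ ∀ i, (Y i).IsSentence ∧ ((Y i).IsTrue ↔ L (H i))

/-!
The learnability conditions quantify over real numbers, arbitrary learners and arbitrary
distributions, and have to be brought down to arithmetic.

*Characterizations.* A predicate is arithmetical as soon as it is built from computable predicates
and partial recursive functions by connectives and quantifiers over encodable types: the graphs of
partial recursive functions are definable with Gödel's beta function
(`Nat.Partrec.definable_graph`, `Arithmetical`). Distributions are replaced by uniform distributions
`listMeasure T` on the positions of a finite list `T`. Every distribution is concentrated up to a
small error on finitely many points, and is there dominated by some `listMeasure T` up to a factor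
close to `1`, so that also the distributions of samples are close (`exists_list_approx`,
`sampleProb_failureEvent_le`). For `listMeasure T`, the failure of a learner is a matter of counting
(`rarelyFails_iff`). The approximation only affects the accuracy and confidence by arbitrarily small
amounts.

For SCPAC learnability, programs for the sample complexity and for the learner are quantified
directly (`SCPACCondition`). A PAC learner is an arbitrary function, and it is not an object of
arithmetic. But for distributions on the inputs below some `N` and a fixed sample size, only
finitely many samples are relevant, and the learner can be taken to be computable. Hence
`PACCondition` asks for a sample size that does not depend on `N` and for a program that depends on
`N`. For the converse, the learners for all `N` are combined (`PACCondition.pacLearnable`): one part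
of the sample serves to find an `N` such that larger inputs are improbable, which needs a number of
points that does not depend on the distribution (`sampleProb_tail_le`), and the other, independent
part is given to the learner for this `N`. This does without the characterization of PAC
learnability by the VC dimension.

*Families.* Maximal families are computable by the parameter theorem, and their nontrivial decision
problems are unsolvable by Rice's theorem.

*Independence.* The theorems of ZFC are computably enumerable: a set that is generated by computably
enumerable rules is computably enumerable (`REPred.derivable`), and natural deduction, the renaming
of variables and the rendering of arithmetical formulas are all given by such rules (`Judgment`).
If only finitely many of the sentences `Y i` were independent, both the set of the `i` with
`L (H i)` and its complement would be computably enumerable: list the right ones among the finitely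
many exceptions, and search for proofs or refutations of the other `Y i`, which can be trusted by
arithmetical soundness.
-/

/-! ### Definability in first-order arithmetic -/

/-- The relation `P` on assignments is defined in `ℕ` by an arithmetical formula whose free
variables are smaller than `k`. -/
def Definable (k : ℕ) (P : (ℕ → ℕ) → Prop) : Prop :=
  ∃ φ : ArithFormula, φ.FreeBelow k ∧ ∀ v, φ.Holds v ↔ P v

theorem ArithTerm.FreeBelow.mono {t : ArithTerm} {k l : ℕ} (h : t.FreeBelow k) (hkl : k ≤ l) :
    t.FreeBelow l := by
  induction t with
  | var n => exact lt_of_lt_of_le h hkl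
  | zero => trivial
  | succ t ih => exact ih h
  | add s t ihs iht => exact ⟨ihs h.1, iht h.2⟩
  | mul s t ihs iht => exact ⟨ihs h.1, iht h.2⟩

theorem ArithFormula.FreeBelow.mono {φ : ArithFormula} {k l : ℕ} (h : φ.FreeBelow k)
    (hkl : k ≤ l) : φ.FreeBelow l := by
  induction φ generalizing k l with
  | eq s t => exact ⟨ArithTerm.FreeBelow.mono h.1 hkl, ArithTerm.FreeBelow.mono h.2 hkl⟩
  | bot => trivial
  | imp φ ψ ihφ ihψ => exact ⟨ihφ h.1 hkl, ihψ h.2 hkl⟩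
  | all φ ih => exact ih (k := k + 1) h (by omega)

namespace Definable

variable {k : ℕ} {P Q : (ℕ → ℕ) → Prop}

theorem of_iff (hP : Definable k P) (h : ∀ v, Q v ↔ P v) : Definable k Q := by
  obtain ⟨φ, hφ, h'⟩ := hP
  exact ⟨φ, hφ, fun v => (h' v).trans (h v).symm⟩

theorem mono {l : ℕ} (hP : Definable k P) (hkl : k ≤ l) : Definable l P := by
  obtain ⟨φ, hφ, h⟩ := hP
  exact ⟨φ, hφ.mono hkl, h⟩

theorem false : Definable k fun _ => False := ⟨.bot, trivial, fun _ => Iff.rfl⟩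

theorem imp (hP : Definable k P) (hQ : Definable k Q) : Definable k fun v => P v → Q v := by
  obtain ⟨φ, hφ, h⟩ := hP
  obtain ⟨ψ, hψ, h'⟩ := hQ
  exact ⟨.imp φ ψ, ⟨hφ, hψ⟩, fun v => imp_congr (h v) (h' v)⟩

theorem not (hP : Definable k P) : Definable k fun v => ¬ P v := hP.imp false

theorem and (hP : Definable k P) (hQ : Definable k Q) : Definable k fun v => P v ∧ Q v :=
  (hP.imp hQ.not).not.of_iff fun v => by tauto

theorem or (hP : Definable k P) (hQ : Definable k Q) : Definable k fun v => P v ∨ Q v :=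
  (hP.not.imp hQ).of_iff fun v => by tauto

theorem all {R : ℕ → (ℕ → ℕ) → Prop}
    (hR : Definable (k + 1) fun v => R (v 0) fun n => v (n + 1)) :
    Definable k fun v => ∀ a, R a v := by
  obtain ⟨φ, hφ, h⟩ := hR
  exact ⟨.all φ, hφ, fun v => forall_congr' fun a => h _⟩

theorem ex {R : ℕ → (ℕ → ℕ) → Prop}
    (hR : Definable (k + 1) fun v => R (v 0) fun n => v (n + 1)) :
    Definable k fun v => ∃ a, R a v :=
  (all (R := fun a v => ¬ R a v) hR.not).not.of_iff fun v => by simp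

theorem eq_term (s t : ArithTerm) (hs : s.FreeBelow k) (ht : t.FreeBelow k) :
    Definable k fun v => s.eval v = t.eval v := ⟨.eq s t, ⟨hs, ht⟩, fun _ => Iff.rfl⟩

theorem lt {i j : ℕ} (hi : i < k) (hj : j < k) : Definable k fun v => v i < v j := by
  refine (ex (R := fun a v => v i + a + 1 = v j) (eq_term (.succ (.add (.var (i + 1)) (.var 0)))
    (.var (j + 1)) ⟨by simpa [ArithTerm.FreeBelow], Nat.succ_pos _⟩ (by
      simpa [ArithTerm.FreeBelow]))).of_iff fun v => ?_
  constructor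
  · intro h
    exact ⟨v j - v i - 1, by omega⟩
  · rintro ⟨a, ha⟩
    omega

theorem eq_zero {i : ℕ} (hi : i < k) : Definable k fun v => v i = 0 :=
  eq_term (.var i) .zero hi trivial

theorem eq_succ {i j : ℕ} (hi : i < k) (hj : j < k) : Definable k fun v => v i = v j + 1 :=
  eq_term (.var i) (.succ (.var j)) hi hj

theorem eq_pair {i j l : ℕ} (hi : i < k) (hj : j < k) (hl : l < k) :
    Definable k fun v => v i = Nat.pair (v j) (v l) := by
  refine (((lt hj hl).and (eq_term (.var i) (.add (.mul (.var l) (.var l)) (.var j)) hi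
    ⟨⟨hl, hl⟩, hj⟩)).or ((lt hj hl).not.and (eq_term (.var i)
      (.add (.add (.mul (.var j) (.var j)) (.var j)) (.var l)) hi
      ⟨⟨⟨hj, hj⟩, hj⟩, hl⟩))).of_iff fun v => ?_
  simp only [ArithTerm.eval, Nat.pair]
  split_ifs with h <;> simp [h]

theorem eq_beta {i j l : ℕ} (hi : i < k) (hj : j < k) (hl : l < k) :
    Definable k fun v => v i = Nat.beta (v j) (v l) := by
  -- `v j = ⟨a, b⟩` and `a = q * ((v l + 1) * b + 1) + v i` with `v i < (v l + 1) * b + 1`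
  have h : Definable k fun v => ∃ a b q d, v j = Nat.pair a b ∧ a = q * d + v i ∧
      d = (v l + 1) * b + 1 ∧ v i < d := by
    refine ex (ex (ex (ex ?_)))
    refine (eq_pair (i := j + 4) (j := 3) (l := 2) ?_ ?_ ?_).and
      ((eq_term (.var 3) (.add (.mul (.var 1) (.var 0)) (.var (i + 4))) ?_ ?_).and
      ((eq_term (.var 0) (.succ (.mul (.succ (.var (l + 4))) (.var 2))) ?_ ?_).and
        (lt (i := i + 4) (j := 0) ?_ ?_))) <;> simp [ArithTerm.FreeBelow] <;> omega
  refine h.of_iff fun v => ?_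
  unfold Nat.beta
  constructor
  · intro h
    refine ⟨(v j).unpair.1, (v j).unpair.2, (v j).unpair.1 / ((v l + 1) * (v j).unpair.2 + 1),
      _, (Nat.pair_unpair _).symm, ?_, rfl, ?_⟩
    · rw [h, mul_comm, Nat.div_add_mod]
    · rw [h]
      exact Nat.mod_lt _ (Nat.succ_pos _)
  · rintro ⟨a, b, q, d, h1, h2, h3, h4⟩
    rw [h1, Nat.unpair_pair]
    simp only
    rw [← h3, h2, Nat.mul_comm, Nat.mul_add_mod, Nat.mod_eq_of_lt h4]

theorem ball_lt {i : ℕ} (hi : i < k) {R : ℕ → (ℕ → ℕ) → Prop}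
    (hR : Definable (k + 1) fun v => R (v 0) fun n => v (n + 1)) :
    Definable k fun v => ∀ a < v i, R a v :=
  all (R := fun a v => a < v i → R a v)
    ((lt (i := 0) (j := i + 1) (Nat.succ_pos _) (by omega)).imp hR)

end Definable

/-- A primitive recursion has the value `y` iff this is witnessed by the sequence of its
intermediate values, coded with Gödel's beta function. -/
theorem mem_prec_iff (f g : ℕ →. ℕ) (a n y : ℕ) :
    y ∈ (n.rec (f a) fun m IH => IH.bind fun i => g (Nat.pair a (Nat.pair m i)) : Part ℕ) ↔
      ∃ z, Nat.beta z 0 ∈ f a ∧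
        (∀ m < n, Nat.beta z (m + 1) ∈ g (Nat.pair a (Nat.pair m (Nat.beta z m)))) ∧
        y = Nat.beta z n := by
  constructor
  · intro h
    -- build the list of intermediate values
    have key : ∃ l : List ℕ, l.length = n + 1 ∧ l.getD 0 0 ∈ f a ∧
        (∀ m < n, l.getD (m + 1) 0 ∈ g (Nat.pair a (Nat.pair m (l.getD m 0)))) ∧
        y = l.getD n 0 := by
      induction n generalizing y with
      | zero => exact ⟨[y], rfl, by simpa using h, by simp, by simp⟩
      | succ n ih =>
        obtain ⟨i, hi, hy⟩ := Part.mem_bind_iff.1 h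
        obtain ⟨l, hl, h0, hs, hn⟩ := ih i hi
        refine ⟨l ++ [y], by simp [hl], ?_, fun m hm => ?_, ?_⟩
        · rwa [List.getD_append _ _ _ _ (by omega)]
        · rw [List.getD_append _ _ _ m (by omega)]
          rcases Nat.lt_succ_iff_lt_or_eq.1 hm with hm | rfl
          · rw [List.getD_append _ _ _ _ (by omega)]
            exact hs m hm
          · rw [List.getD_append_right _ _ _ _ (by omega), ← hn, hl]
            simpa using hy
        · rw [List.getD_append_right _ _ _ _ (by omega), hl]
          simp
    obtain ⟨l, hl, h0, hs, hn⟩ := key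
    have hb : ∀ i ≤ n, Nat.beta (Nat.unbeta l) i = l.getD i 0 := fun i hi => by
      rw [List.getD_eq_getElem _ _ (by omega)]
      exact Nat.beta_unbeta_coe l ⟨i, by omega⟩
    refine ⟨Nat.unbeta l, ?_, fun m hm => ?_, ?_⟩
    · rwa [hb 0 (by omega)]
    · rw [hb _ hm, hb _ hm.le]
      exact hs m hm
    · rwa [hb n le_rfl]
  · rintro ⟨z, h0, hs, rfl⟩
    induction n with
    | zero => exact h0
    | succ n ih =>
      exact Part.mem_bind_iff.2 ⟨_, ih fun m hm => hs m (by omega), hs n (by omega)⟩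

/-- The graphs of partial recursive functions are arithmetical. -/
theorem Nat.Partrec.definable_graph {f : ℕ →. ℕ} (hf : Nat.Partrec f) :
    ∀ {k i j : ℕ}, i < k → j < k → Definable k fun v => v i ∈ f (v j) := by
  induction hf with
  | zero =>
    intro k i j hi hj
    exact (Definable.eq_zero hi).of_iff fun v => by
      simp [pure, PFun.pure]
  | succ =>
    intro k i j hi hj
    exact (Definable.eq_succ hi hj).of_iff fun v => by simp
  | left =>
    intro k i j hi hj
    refine (Definable.ex (R := fun a v => v j = Nat.pair (v i) a)
      (Definable.eq_pair (i := j + 1) (j := i + 1) (l := 0) (by omega) (by omega)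
        (by omega))).of_iff fun v => ?_
    constructor
    · intro h
      refine ⟨(v j).unpair.2, ?_⟩
      have : v i = (v j).unpair.1 := by simpa using h
      rw [this, Nat.pair_unpair]
    · rintro ⟨a, ha⟩
      simp [ha]
  | right =>
    intro k i j hi hj
    refine (Definable.ex (R := fun a v => v j = Nat.pair a (v i))
      (Definable.eq_pair (i := j + 1) (j := 0) (l := i + 1) (by omega) (by omega)
        (by omega))).of_iff fun v => ?_
    constructor
    · intro h
      refine ⟨(v j).unpair.1, ?_⟩
      have : v i = (v j).unpair.2 := by simpa using h
      rw [this, Nat.pair_unpair]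
    · rintro ⟨a, ha⟩
      simp [ha]
  | @pair f g hf hg ihf ihg =>
    intro k i j hi hj
    have h : Definable k fun v => ∃ a b, a ∈ f (v j) ∧ b ∈ g (v j) ∧ v i = Nat.pair a b := by
      refine Definable.ex (Definable.ex ?_)
      refine (ihf (i := 1) (j := j + 2) ?_ ?_).and ((ihg (i := 0) (j := j + 2) ?_ ?_).and
        (Definable.eq_pair (i := i + 2) (j := 1) (l := 0) ?_ ?_ ?_)) <;> omega
    refine h.of_iff fun v => ?_
    simp only [Seq.seq, Part.map_eq_map, Part.mem_bind_iff, Part.mem_map_iff]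
    constructor
    · rintro ⟨_, ⟨a, ha, rfl⟩, b, hb, h⟩
      exact ⟨a, b, ha, hb, h.symm⟩
    · rintro ⟨a, b, ha, hb, h⟩
      exact ⟨_, ⟨a, ha, rfl⟩, b, hb, h.symm⟩
  | @comp f g hf hg ihf ihg =>
    intro k i j hi hj
    have h : Definable k fun v => ∃ b, b ∈ g (v j) ∧ v i ∈ f b := by
      refine Definable.ex ?_
      refine (ihg (i := 0) (j := j + 1) ?_ ?_).and (ihf (i := i + 1) (j := 0) ?_ ?_) <;> omega
    exact h.of_iff fun v => Part.mem_bind_iff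
  | @prec f g hf hg ihf ihg =>
    intro k i j hi hj
    have h : Definable k fun v => ∃ a n, v j = Nat.pair a n ∧ ∃ z,
        (∃ y, (∃ o, o = 0 ∧ y = Nat.beta z o) ∧ y ∈ f a) ∧
        (∀ m < n, ∃ m', m' = m + 1 ∧ ∃ c d x x', c = Nat.beta z m ∧ d = Nat.beta z m' ∧
          x = Nat.pair m c ∧ x' = Nat.pair a x ∧ d ∈ g x') ∧
        v i = Nat.beta z n := by
      refine Definable.ex (Definable.ex ((Definable.eq_pair (i := j + 2) (j := 1) (l := 0)
        (by omega) (by omega) (by omega)).and (Definable.ex (Definable.and ?_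
          (Definable.and (Definable.ball_lt (i := 1) (by omega) ?_)
            (Definable.eq_beta (i := i + 3) (j := 0) (l := 1) (by omega) (by omega)
              (by omega)))))))
      · refine Definable.ex (Definable.and (Definable.ex ((Definable.eq_zero (i := 0) ?_).and
          (Definable.eq_beta (i := 1) (j := 2) (l := 0) ?_ ?_ ?_)))
          (ihf (i := 0) (j := 3) ?_ ?_)) <;> omega
      · refine Definable.ex ((Definable.eq_succ (i := 0) (j := 1) ?_ ?_).and (Definable.ex
          (Definable.ex (Definable.ex (Definable.ex
          ((Definable.eq_beta (i := 3) (j := 6) (l := 5) ?_ ?_ ?_).and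
          ((Definable.eq_beta (i := 2) (j := 6) (l := 4) ?_ ?_ ?_).and
          ((Definable.eq_pair (i := 1) (j := 5) (l := 3) ?_ ?_ ?_).and
          ((Definable.eq_pair (i := 0) (j := 8) (l := 1) ?_ ?_ ?_).and
          (ihg (i := 2) (j := 0) ?_ ?_)))))))))) <;> omega
    refine h.of_iff fun v => ?_
    refine (mem_prec_iff f g (v j).unpair.1 (v j).unpair.2 (v i)).trans ?_
    constructor
    · rintro ⟨z, h0, hs, hn⟩
      exact ⟨_, _, (Nat.pair_unpair _).symm, z, ⟨_, ⟨_, rfl, rfl⟩, h0⟩,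
        fun m hm => ⟨_, rfl, _, _, _, _, rfl, rfl, rfl, rfl, hs m hm⟩, hn⟩
    · rintro ⟨a, n, hp, z, ⟨_, ⟨_, rfl, rfl⟩, h0⟩, hs, hn⟩
      rw [hp, Nat.unpair_pair]
      refine ⟨z, h0, fun m hm => ?_, hn⟩
      obtain ⟨_, rfl, _, _, _, _, rfl, rfl, rfl, rfl, h⟩ := hs m hm
      exact h
  | @rfind f hf ihf =>
    intro k i j hi hj
    have h : Definable k fun v => (∃ x, x = Nat.pair (v j) (v i) ∧ ∃ o, o = 0 ∧ o ∈ f x) ∧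
        ∀ m < v i, ∃ x, x = Nat.pair (v j) m ∧ ∃ o, ¬ o = 0 ∧ o ∈ f x := by
      refine Definable.and (Definable.ex ((Definable.eq_pair (i := 0) (j := j + 1) (l := i + 1)
        ?_ ?_ ?_).and (Definable.ex ((Definable.eq_zero (i := 0) ?_).and (ihf (i := 0) (j := 1)
        ?_ ?_))))) (Definable.ball_lt hi (Definable.ex ((Definable.eq_pair (i := 0) (j := j + 2)
        (l := 1) ?_ ?_ ?_).and (Definable.ex ((Definable.eq_zero (i := 0) ?_).not.and
        (ihf (i := 0) (j := 1) ?_ ?_)))))) <;> omega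
    refine h.of_iff fun v => ?_
    refine Nat.mem_rfind.trans ?_
    simp only [Part.map_eq_map, Part.mem_map_iff, decide_eq_true_eq,
      decide_eq_false_iff_not, exists_eq_left]
    constructor
    · rintro ⟨⟨a, ha, h0⟩, h'⟩
      refine ⟨h0 ▸ ha, fun m hm => ?_⟩
      obtain ⟨a, ha, h0⟩ := h' hm
      exact ⟨a, h0, ha⟩
    · rintro ⟨h, h'⟩
      refine ⟨⟨0, h, rfl⟩, fun {m} hm => ?_⟩
      obtain ⟨a, h0, ha⟩ := h' m hm
      exact ⟨a, ha, h0⟩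

/-! ### Arithmetical predicates on encodable types -/

section Arithmetical

variable {α β γ : Type} [Primcodable α] [Primcodable β] [Primcodable γ]

/-- The predicate `P` is arithmetical: on codes it agrees with a set of natural numbers that is
defined by an arithmetical formula. -/
def Arithmetical (P : α → Prop) : Prop :=
  ∃ Q : ℕ → Prop, (Definable 1 fun v => Q (v 0)) ∧ ∀ a, Q (Encodable.encode a) ↔ P a

namespace Arithmetical

theorem of_iff {P Q : α → Prop} (hP : Arithmetical P) (h : ∀ a, Q a ↔ P a) :
    Arithmetical Q := by
  obtain ⟨R, hR, h'⟩ := hP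
  exact ⟨R, hR, fun a => (h' a).trans (h a).symm⟩

theorem imp {P Q : α → Prop} (hP : Arithmetical P) (hQ : Arithmetical Q) :
    Arithmetical fun a => P a → Q a := by
  obtain ⟨R, hR, h⟩ := hP
  obtain ⟨R', hR', h'⟩ := hQ
  exact ⟨fun n => R n → R' n, hR.imp hR', fun a => imp_congr (h a) (h' a)⟩

theorem not {P : α → Prop} (hP : Arithmetical P) : Arithmetical fun a => ¬ P a := by
  obtain ⟨R, hR, h⟩ := hP
  exact ⟨fun n => ¬ R n, hR.not, fun a => not_congr (h a)⟩

theorem and {P Q : α → Prop} (hP : Arithmetical P) (hQ : Arithmetical Q) :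
    Arithmetical fun a => P a ∧ Q a := by
  obtain ⟨R, hR, h⟩ := hP
  obtain ⟨R', hR', h'⟩ := hQ
  exact ⟨fun n => R n ∧ R' n, hR.and hR', fun a => and_congr (h a) (h' a)⟩

/-- Substitution of a partial recursive function. -/
theorem exists_mem {P : β → Prop} (hP : Arithmetical P) {f : α →. β} (hf : Partrec f) :
    Arithmetical fun a => ∃ b ∈ f a, P b := by
  obtain ⟨R, hR, h⟩ := hP
  refine ⟨fun n => ∃ y, y ∈ (Part.bind (Encodable.decode (α := α) n)
    fun a => (f a).map Encodable.encode) ∧ R y, ?_, fun a => ?_⟩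
  · exact Definable.ex ((Nat.Partrec.definable_graph hf (i := 0) (j := 1) (by omega)
      (by omega)).and (hR.mono (by omega)))
  · simp only [Encodable.encodek, Part.coe_some, Part.bind_some, Part.mem_map_iff]
    constructor
    · rintro ⟨_, ⟨b, hb, rfl⟩, hy⟩
      exact ⟨b, hb, (h b).1 hy⟩
    · rintro ⟨b, hb, hP⟩
      exact ⟨_, ⟨b, hb, rfl⟩, (h b).2 hP⟩

theorem comp {P : β → Prop} (hP : Arithmetical P) {f : α → β} (hf : Computable f) :
    Arithmetical fun a => P (f a) :=
  (hP.exists_mem hf.partrec).of_iff fun a => by simp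

theorem of_computable {f : α → Bool} (hf : Computable f) : Arithmetical fun a => f a = true := by
  have h : Arithmetical fun b : Bool => b = true :=
    ⟨fun n => n = 1, (Definable.eq_term (.var 0) (.succ .zero) Nat.one_pos trivial).of_iff
      fun v => by simp [ArithTerm.eval], fun b => by cases b <;> simp⟩
  exact h.comp hf

theorem of_computablePred {P : α → Prop} (hP : ComputablePred P) : Arithmetical P := by
  obtain ⟨_, hf⟩ := hP
  exact (of_computable hf).of_iff fun a => by simp

theorem of_primrecPred {P : α → Prop} (hP : PrimrecPred P) : Arithmetical P :=
  of_computablePred hP.computablePred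

theorem mem_partrec {f : α →. β} (hf : Partrec f) [DecidableEq β] :
    Arithmetical fun p : α × β => p.2 ∈ f p.1 := by
  have h : Arithmetical fun p : β × β => p.1 = p.2 := of_primrecPred Primrec.eq
  have h' : Partrec fun p : α × β => (f p.1).map fun b => (p.2, b) :=
    (hf.comp Computable.fst).map ((Computable.snd.comp Computable.fst).pair Computable.snd)
  refine (h.exists_mem h').of_iff fun p => ?_
  constructor
  · intro hp
    exact ⟨(p.2, p.2), Part.mem_map _ hp, rfl⟩
  · rintro ⟨b, hb, h⟩
    obtain ⟨c, hc, rfl⟩ := (Part.mem_map_iff _).1 hb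
    simp only at h
    rwa [h]

theorem all_nat {P : α → ℕ → Prop} (hP : Arithmetical fun p : α × ℕ => P p.1 p.2) :
    Arithmetical fun a => ∀ n, P a n := by
  obtain ⟨R, hR, h⟩ := hP
  refine ⟨fun n => ∀ m, ∃ z, z = Nat.pair n m ∧ R z, ?_, fun a => forall_congr' fun m => ?_⟩
  · exact Definable.all (Definable.ex ((Definable.eq_pair (i := 0) (j := 2) (l := 1) (by omega)
      (by omega) (by omega)).and (hR.mono (by omega))))
  · simpa using h (a, m)

theorem all {P : α → β → Prop} (hP : Arithmetical fun p : α × β => P p.1 p.2) :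
    Arithmetical fun a => ∀ b, P a b := by
  -- quantify over a natural number that is decoded to an element of `β`
  have hf : Partrec fun p : α × ℕ =>
      ((Encodable.decode (α := β) p.2 : Part β).map fun b => (p.1, b)) :=
    Partrec.map (Computable.ofOption (Computable.decode.comp Computable.snd))
      ((Computable.fst.comp Computable.fst).pair Computable.snd)
  refine (all_nat (P := fun a n => ¬ ∃ q ∈ (Encodable.decode (α := β) n : Part β).map
    fun b => (a, b), ¬ P q.1 q.2) (hP.not.exists_mem hf).not).of_iff fun a => ?_
  constructor
  · rintro h n ⟨q, hq, hq'⟩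
    obtain ⟨b, -, rfl⟩ := (Part.mem_map_iff _).1 hq
    exact hq' (h b)
  · intro h b
    by_contra hb
    exact h (Encodable.encode b) ⟨(a, b), by simp, hb⟩

theorem ex {P : α → β → Prop} (hP : Arithmetical fun p : α × β => P p.1 p.2) :
    Arithmetical fun a => ∃ b, P a b :=
  (all (P := fun a b => ¬ P a b) hP.not).not.of_iff fun a => by simp

end Arithmetical

end Arithmetical

/-! ### Instances of arithmetical formulas at numerals -/

namespace ArithTerm

theorem eval_numeral (n : ℕ) (v : ℕ → ℕ) : (numeral n).eval v = n := by
  induction n with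
  | zero => rfl
  | succ n ih => simp [numeral, eval, ih]

theorem freeBelow_numeral (n k : ℕ) : (numeral n).FreeBelow k := by
  induction n with
  | zero => trivial
  | succ n ih => exact ih

theorem eval_substNumeral (n k : ℕ) (t : ArithTerm) (v : ℕ → ℕ) :
    (t.substNumeral n k).eval v = t.eval (Function.update v k n) := by
  induction t with
  | var j =>
    by_cases h : j = k
    · simp [substNumeral, eval, h, eval_numeral]
    · simp [substNumeral, eval, h]
  | zero => rfl
  | succ t ih => simp [substNumeral, eval, ih]
  | add s t ihs iht => simp [substNumeral, eval, ihs, iht]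
  | mul s t ihs iht => simp [substNumeral, eval, ihs, iht]

theorem FreeBelow.substNumeral {t : ArithTerm} {k : ℕ} (h : t.FreeBelow (k + 1)) (n : ℕ) :
    (t.substNumeral n k).FreeBelow k := by
  induction t with
  | var j =>
    have hj : j < k + 1 := h
    by_cases hjk : j = k
    · simpa [ArithTerm.substNumeral, hjk] using freeBelow_numeral n k
    · simp only [ArithTerm.substNumeral, hjk, if_false]
      exact lt_of_le_of_ne (Nat.lt_succ_iff.1 hj) hjk
  | zero => trivial
  | succ t ih => exact ih h
  | add s t ihs iht => exact ⟨ihs h.1, iht h.2⟩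
  | mul s t ihs iht => exact ⟨ihs h.1, iht h.2⟩

theorem code_injective : Function.Injective code := by
  intro s
  induction s with
  | var n => intro t h; cases t <;> simp_all [code]
  | zero => intro t h; cases t <;> simp_all [code]
  | succ s ih =>
    intro t h
    cases t <;> simp [code] at h
    rw [ih h]
  | add s s' ih ih' =>
    intro t h
    cases t <;> simp [code] at h
    rw [ih h.1, ih' h.2]
  | mul s s' ih ih' =>
    intro t h
    cases t <;> simp [code] at h
    rw [ih h.1, ih' h.2]

end ArithTerm

namespace ArithFormula

theorem holds_substNumeral (n k : ℕ) (φ : ArithFormula) (v : ℕ → ℕ) :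
    (φ.substNumeral n k).Holds v ↔ φ.Holds (Function.update v k n) := by
  induction φ generalizing k v with
  | eq s t => simp [substNumeral, Holds, ArithTerm.eval_substNumeral]
  | bot => rfl
  | imp φ ψ ihφ ihψ => exact imp_congr (ihφ k v) (ihψ k v)
  | all φ ih =>
    refine forall_congr' fun a => (ih (k + 1) _).trans (Eq.to_iff ?_)
    congr 1
    funext j
    cases j with
    | zero => simp
    | succ j => simp [Function.update_apply]

theorem FreeBelow.substNumeral {φ : ArithFormula} {k : ℕ} (h : φ.FreeBelow (k + 1)) (n : ℕ) :
    (φ.substNumeral n k).FreeBelow k := by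
  induction φ generalizing k with
  | eq s t => exact ⟨ArithTerm.FreeBelow.substNumeral h.1 n, ArithTerm.FreeBelow.substNumeral h.2 n⟩
  | bot => trivial
  | imp φ ψ ihφ ihψ => exact ⟨ihφ h.1, ihψ h.2⟩
  | all φ ih => exact ih (k := k + 1) h

theorem code_injective : Function.Injective code := by
  intro φ
  induction φ with
  | eq s s' =>
    intro ψ h
    cases ψ <;> simp [code] at h
    rw [ArithTerm.code_injective h.1, ArithTerm.code_injective h.2]
  | bot => intro ψ h; cases ψ <;> simp_all [code]
  | imp φ φ' ih ih' =>
    intro ψ h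
    cases ψ <;> simp [code] at h
    rw [ih h.1, ih' h.2]
  | all φ ih =>
    intro ψ h
    cases ψ <;> simp [code] at h
    rw [ih h]

end ArithFormula

/-- Arithmetical properties of indices yield arithmetical characterizations. -/
theorem Arithmetical.arithmeticallyCharacterizable {P : ℕ → Prop} (hP : Arithmetical P)
    {L : Set Hypothesis → Prop} (h : ∀ e, IsRERIndex e → (P e ↔ L (hypClass e))) :
    ArithmeticallyCharacterizable L := by
  obtain ⟨Q, ⟨ψ, hψ, hQ⟩, hP⟩ := hP
  refine ⟨ψ, hψ, fun e he => ?_⟩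
  rw [← h e he, ← hP e]
  simp only [ArithFormula.IsTrue, ArithFormula.atNumeral, ArithFormula.holds_substNumeral, hQ]
  simp

/-! ### Computable functions -/

attribute [fun_prop] Computable Computable.id Computable.const Computable.pair Computable.comp

namespace Computable

variable {α β γ : Type} [Primcodable α] [Primcodable β] [Primcodable γ]

@[fun_prop]
theorem fst' {f : α → β × γ} (hf : Computable f) : Computable fun a => (f a).1 := fst.comp hf

@[fun_prop]
theorem snd' {f : α → β × γ} (hf : Computable f) : Computable fun a => (f a).2 := snd.comp hf

@[fun_prop]
theorem natPair {f g : α → ℕ} (hf : Computable f) (hg : Computable g) :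
    Computable fun a => Nat.pair (f a) (g a) := (Primrec₂.natPair.to_comp).comp hf hg

@[fun_prop]
theorem natUnpair {f : α → ℕ} (hf : Computable f) : Computable fun a => Nat.unpair (f a) :=
  unpair.comp hf

@[fun_prop]
theorem natAdd {f g : α → ℕ} (hf : Computable f) (hg : Computable g) :
    Computable fun a => f a + g a := (Primrec.nat_add.to_comp).comp hf hg

@[fun_prop]
theorem natMul {f g : α → ℕ} (hf : Computable f) (hg : Computable g) :
    Computable fun a => f a * g a := (Primrec.nat_mul.to_comp).comp hf hg

@[fun_prop]
theorem natSub {f g : α → ℕ} (hf : Computable f) (hg : Computable g) :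
    Computable fun a => f a - g a := (Primrec.nat_sub.to_comp).comp hf hg

@[fun_prop]
theorem encode' {f : α → β} (hf : Computable f) : Computable fun a => Encodable.encode (f a) :=
  Computable.encode.comp hf

@[fun_prop]
theorem cons' {f : α → β} {g : α → List β} (hf : Computable f) (hg : Computable g) :
    Computable fun a => f a :: g a := list_cons.comp hf hg

@[fun_prop]
theorem append' {f g : α → List β} (hf : Computable f) (hg : Computable g) :
    Computable fun a => f a ++ g a := list_append.comp hf hg

@[fun_prop]
theorem getElem?' {f : α → List β} {g : α → ℕ} (hf : Computable f) (hg : Computable g) :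
    Computable fun a => (f a)[g a]? := list_getElem?.comp hf hg

@[fun_prop]
theorem length' {f : α → List β} (hf : Computable f) : Computable fun a => (f a).length :=
  list_length.comp hf

@[fun_prop]
theorem some' {f : α → β} (hf : Computable f) : Computable fun a => some (f a) :=
  option_some.comp hf

@[fun_prop]
theorem inl' {f : α → β} (hf : Computable f) : Computable fun a => (Sum.inl (f a) : β ⊕ γ) :=
  sumInl.comp hf

@[fun_prop]
theorem inr' {f : α → γ} (hf : Computable f) : Computable fun a => (Sum.inr (f a) : β ⊕ γ) :=
  sumInr.comp hf

@[fun_prop]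
theorem decide_eq {f g : α → β} [DecidableEq β] (hf : Computable f) (hg : Computable g) :
    Computable fun a => decide (f a = g a) := by
  obtain ⟨_, h⟩ := (Primrec.eq (α := β)).computablePred
  refine (h.comp (hf.pair hg)).of_eq fun a => ?_
  simp

@[fun_prop]
theorem decide_lt {f g : α → ℕ} (hf : Computable f) (hg : Computable g) :
    Computable fun a => decide (f a < g a) := by
  obtain ⟨_, h⟩ := (Primrec.nat_lt).computablePred
  refine (h.comp (hf.pair hg)).of_eq fun a => ?_
  simp

@[fun_prop]
theorem and' {f g : α → Bool} (hf : Computable f) (hg : Computable g) :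
    Computable fun a => f a && g a := (Primrec.and.to_comp).comp hf hg

@[fun_prop]
theorem or' {f g : α → Bool} (hf : Computable f) (hg : Computable g) :
    Computable fun a => f a || g a := (Primrec.or.to_comp).comp hf hg

@[fun_prop]
theorem curry' {g : α → Nat.Partrec.Code} {h : α → ℕ} (hg : Computable g) (hh : Computable h) :
    Computable fun a => Nat.Partrec.Code.curry (g a) (h a) :=
  (Nat.Partrec.Code.primrec₂_curry.to_comp).comp hg hh

end Computable

/-! ### Computably enumerable predicates -/

section REPred

variable {α β : Type} [Primcodable α] [Primcodable β]

theorem rePred_of_computable {p : α → Prop} {q : α × ℕ → Bool} (hq : Computable q)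
    (h : ∀ a, p a ↔ ∃ n, q (a, n) = true) : REPred p := by
  have : Partrec fun a => Nat.rfind fun n => (Part.some (q (a, n)) : Part Bool) :=
    Partrec.rfind (p := fun a n => (Part.some (q (a, n)) : Part Bool)) hq.partrec
  refine this.dom_re.of_eq fun a => ?_
  rw [h a]
  constructor
  · intro hd
    obtain ⟨n, hn, -⟩ := Nat.rfind_dom.1 hd
    exact ⟨n, (Part.mem_some_iff.1 hn).symm⟩
  · rintro ⟨n, hn⟩
    exact Nat.rfind_dom.2 ⟨n, Part.mem_some_iff.2 hn.symm, fun _ => trivial⟩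

/-- A predicate is computably enumerable iff it is a projection of a primitive recursive one. -/
theorem rePred_iff_primrec {p : α → Prop} :
    REPred p ↔ ∃ q : α × ℕ → Bool, Primrec q ∧ ∀ a, p a ↔ ∃ n, q (a, n) = true := by
  constructor
  · intro h
    obtain ⟨c, hc⟩ := Nat.Partrec.Code.exists_code.1 h
    refine ⟨fun x => (Nat.Partrec.Code.evaln x.2 c (Encodable.encode x.1)).isSome,
      Primrec.option_isSome.comp (Nat.Partrec.Code.primrec_evaln.comp
        ((Primrec.snd.pair (Primrec.const c)).pair (Primrec.encode.comp Primrec.fst))),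
      fun a => ?_⟩
    have h1 : p a ↔ (c.eval (Encodable.encode a)).Dom := by
      rw [hc]
      simp [Part.assert]
    rw [h1, Part.dom_iff_mem]
    simp only [Nat.Partrec.Code.evaln_complete, Option.isSome_iff_exists, Option.mem_def]
    exact exists_comm
  · rintro ⟨q, hq, h⟩
    exact rePred_of_computable hq.to_comp h

/-- A predicate is computably enumerable iff it is a projection of a decidable one. -/
theorem rePred_iff {p : α → Prop} :
    REPred p ↔ ∃ q : α × ℕ → Bool, Computable q ∧ ∀ a, p a ↔ ∃ n, q (a, n) = true :=
  ⟨fun h => (rePred_iff_primrec.1 h).imp fun _ hq => ⟨hq.1.to_comp, hq.2⟩,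
    fun ⟨_, hq, h⟩ => rePred_of_computable hq h⟩

namespace REPred

theorem or {p q : α → Prop} (hp : REPred p) (hq : REPred q) : REPred fun a => p a ∨ q a := by
  obtain ⟨f, hf, h⟩ := rePred_iff.1 hp
  obtain ⟨g, hg, h'⟩ := rePred_iff.1 hq
  refine rePred_iff.2 ⟨fun x => f x || g x, by fun_prop, fun a => ?_⟩
  simp [h, h', exists_or]

theorem and {p q : α → Prop} (hp : REPred p) (hq : REPred q) : REPred fun a => p a ∧ q a := by
  obtain ⟨f, hf, h⟩ := rePred_iff.1 hp
  obtain ⟨g, hg, h'⟩ := rePred_iff.1 hq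
  refine rePred_iff.2 ⟨fun x => f (x.1, x.2.unpair.1) && g (x.1, x.2.unpair.2), by fun_prop,
    fun a => ?_⟩
  simp only [h, h', Bool.and_eq_true]
  constructor
  · rintro ⟨⟨m, hm⟩, n, hn⟩
    exact ⟨Nat.pair m n, by simp [hm, hn]⟩
  · rintro ⟨n, hn⟩
    exact ⟨⟨_, hn.1⟩, _, hn.2⟩

theorem comp {p : β → Prop} (hp : REPred p) {f : α → β} (hf : Computable f) :
    REPred fun a => p (f a) := Partrec.comp hp hf

theorem of_computable {f : α → Bool} (hf : Computable f) : REPred fun a => f a = true :=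
  rePred_iff.2 ⟨fun x => f x.1, by fun_prop, fun a => by simp⟩

theorem exists_snd {p : α × β → Prop} (hp : REPred p) : REPred fun a => ∃ b, p (a, b) := by
  obtain ⟨f, hf, h⟩ := rePred_iff.1 hp
  refine rePred_iff.2 ⟨fun x => ((Encodable.decode (α := β) x.2.unpair.1).map
    fun b => f ((x.1, b), x.2.unpair.2)).getD false, ?_, fun a => ?_⟩
  · refine Computable.option_getD (Computable.option_map (Computable.decode.comp (by fun_prop)) ?_)
      (Computable.const false)
    exact Computable.to₂ (f := fun y : (α × ℕ) × β => f ((y.1.1, y.2), y.1.2.unpair.2))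
      (by fun_prop)
  · constructor
    · rintro ⟨b, hb⟩
      obtain ⟨n, hn⟩ := (h _).1 hb
      exact ⟨Nat.pair (Encodable.encode b) n, by simp [hn]⟩
    · rintro ⟨n, hn⟩
      cases hd : (Encodable.decode (α := β) n.unpair.1) with
      | none => simp [hd] at hn
      | some b => exact ⟨b, (h _).2 ⟨n.unpair.2, by simpa [hd] using hn⟩⟩

theorem range [DecidableEq β] {f : α → β} (hf : Computable f) : REPred fun b => ∃ a, f a = b :=
  exists_snd (p := fun x : β × α => f x.2 = x.1)
    ((of_computable (f := fun x : β × α => decide (f x.2 = x.1)) (by fun_prop)).of_eq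
      fun a => by simp)

end REPred

end REPred

/-! ### Instances of a formula express learnability -/

theorem ArithTerm.computable_code_substNumeral (t : ArithTerm) (k : ℕ) :
    Computable fun n => (t.substNumeral n k).code := by
  induction t with
  | var j =>
    by_cases h : j = k
    · simp only [ArithTerm.substNumeral, h, if_true]
      have : Primrec fun n => (ArithTerm.numeral n).code := by
        refine (Primrec.nat_rec₁ (f := fun _ c => Nat.pair 2 c) (Nat.pair 1 0)
          ((Primrec₂.natPair.comp (Primrec.const 2) Primrec.snd))).of_eq fun n => ?_
        induction n with
        | zero => rfl
        | succ n ih => simp [ArithTerm.numeral, ArithTerm.code, ← ih]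
      exact this.to_comp
    · simp only [ArithTerm.substNumeral, h, if_false]
      fun_prop
  | zero => exact Computable.const _
  | succ t ih => simp only [ArithTerm.substNumeral, ArithTerm.code]; fun_prop
  | add s t ihs iht => simp only [ArithTerm.substNumeral, ArithTerm.code]; fun_prop
  | mul s t ihs iht => simp only [ArithTerm.substNumeral, ArithTerm.code]; fun_prop

theorem ArithFormula.computable_code_substNumeral (φ : ArithFormula) (k : ℕ) :
    Computable fun n => (φ.substNumeral n k).code := by
  induction φ generalizing k with
  | eq s t =>
    have hs := s.computable_code_substNumeral k
    have ht := t.computable_code_substNumeral k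
    simp only [ArithFormula.substNumeral, ArithFormula.code]
    fun_prop
  | bot => exact Computable.const _
  | imp φ ψ ihφ ihψ =>
    have hφ := ihφ k
    have hψ := ihψ k
    simp only [ArithFormula.substNumeral, ArithFormula.code]
    fun_prop
  | all φ ih =>
    have h := ih (k + 1)
    simp only [ArithFormula.substNumeral, ArithFormula.code]
    fun_prop

theorem Characterizes.expressesLearnability {L : Set Hypothesis → Prop} {ψ : ArithFormula}
    (hψ : Characterizes ψ L) {H : ℕ → Set Hypothesis} {r : ℕ → ℕ} (hr : RepresentsFamily r H) :
    ExpressesLearnability L H fun i => ψ.atNumeral (r i) := by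
  refine ⟨(ψ.computable_code_substNumeral 0).comp hr.1, fun i =>
    ⟨ArithFormula.FreeBelow.substNumeral hψ.1 _, ?_⟩⟩
  rw [hψ.2 _ (hr.2 i).1, ← (hr.2 i).2]

/-! ### Maximal families -/

theorem Nat.Partrec.phi {f : ℕ →. ℕ} (hf : Nat.Partrec f) : ∃ i, phi i = f := by
  obtain ⟨c, hc⟩ := Nat.Partrec.Code.exists_code.1 hf
  exact ⟨Encodable.encode c, by simp [_root_.phi, hc]⟩

/-- The parameter theorem for the numbering `phi`. -/
theorem exists_phi_curry {α : Type} [Primcodable α] {f : ℕ × ℕ →. α} (hf : Partrec f) :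
    ∃ s : ℕ → ℕ, Computable s ∧ ∀ i x, phi (s i) x = (f (i, x)).map Encodable.encode := by
  obtain ⟨c, hc⟩ := Nat.Partrec.Code.exists_code.1 hf
  refine ⟨fun i => Encodable.encode (c.curry i), by fun_prop, fun i x => ?_⟩
  rw [phi, Denumerable.ofNat_encode, Nat.Partrec.Code.eval_curry, hc]
  simp

theorem partrec_phi : Partrec₂ phi :=
  Nat.Partrec.Code.eval_part.comp ((Computable.ofNat _).comp Computable.fst) Computable.snd

theorem rePred_mem_W : REPred fun x : ℕ × ℕ => x.2 ∈ W x.1 := Partrec.dom_re partrec_phi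

theorem Computes.eq {k : ℕ} {h h' : Hypothesis} (hk : Computes k h) (hk' : Computes k h') :
    h = h' := by
  funext x
  have := (hk x).symm.trans (hk' x)
  have := Part.some_inj.1 this
  revert this
  cases h x <;> cases h' x <;> simp

theorem IsMaximalFamily.isComputableFamily {H : ℕ → Set Hypothesis} (hH : IsMaximalFamily H) :
    IsComputableFamily H := by
  obtain ⟨C, hC, hH⟩ := hH
  -- `g k` is a program for `C k`
  obtain ⟨g, hg, hgC⟩ := exists_phi_curry (f := fun x => Part.some (C x.1 x.2)) hC.partrec
  have hcomp : ∀ k, Computes (g k) (C k) := fun k x => by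
    rw [hgC]
    cases C k x <;> simp
  -- `r i` enumerates the image under `g` of the `i`th c.e. set
  have hre : REPred fun x : ℕ × ℕ => ∃ k, g k = x.2 ∧ k ∈ W x.1 := by
    refine REPred.exists_snd (p := fun y : (ℕ × ℕ) × ℕ => g y.2 = y.1.2 ∧ y.2 ∈ W y.1.1)
      (REPred.and ?_ ?_)
    · exact (REPred.of_computable (f := fun y : (ℕ × ℕ) × ℕ => decide (g y.2 = y.1.2))
        (by fun_prop)).of_eq fun a => by simp
    · exact rePred_mem_W.comp (f := fun y : (ℕ × ℕ) × ℕ => (y.1.1, y.2)) (by fun_prop)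
  obtain ⟨r, hr, hrW⟩ := exists_phi_curry hre
  have hW : ∀ i, W (r i) = g '' W i := fun i => by
    ext n
    change (phi (r i) n).Dom ↔ _
    simp [hrW, Part.assert, and_comm]
  refine ⟨r, hr, fun i => ⟨fun k hk => ?_, ?_⟩⟩
  · rw [hW] at hk
    obtain ⟨j, -, rfl⟩ := hk
    exact ⟨C j, hcomp j⟩
  · ext h
    simp only [hH, hypClass, hW, Set.mem_image, Set.mem_ofPred_eq, exists_exists_and_eq_and]
    exact exists_congr fun j => and_congr_right fun _ =>
      ⟨fun h => h ▸ hcomp j, fun h => (hcomp j).eq h⟩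

/-- Rice's theorem for the learnability decision problems of maximal families. -/
theorem IsMaximalFamily.not_learnabilitySolvable {H : ℕ → Set Hypothesis}
    (hH : IsMaximalFamily H) {L : Set Hypothesis → Prop} (h : ∃ i, L (H i)) (h' : ∃ i, ¬ L (H i)) :
    ¬ LearnabilitySolvable L H := by
  obtain ⟨C, hC, hH⟩ := hH
  obtain ⟨i, hi⟩ := h
  obtain ⟨j, hj⟩ := h'
  intro hL
  -- the property `L (H i)` depends only on the partial function `phi i`
  let S : Set (ℕ →. ℕ) := {f | L (C '' {n | (f n).Dom})}
  have hS : ComputablePred fun c : Nat.Partrec.Code => c.eval ∈ S := by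
    obtain ⟨f, hf, hfL⟩ := ComputablePred.computable_iff.1 hL
    refine ComputablePred.computable_iff.2 ⟨fun c => f (Encodable.encode c), by fun_prop, ?_⟩
    funext c
    have := congrFun hfL (Encodable.encode c)
    simp only [hH, W, phi, Denumerable.ofNat_encode] at this
    exact this
  have hphi : ∀ i, Nat.Partrec (phi i) := fun i =>
    Nat.Partrec.Code.exists_code.2 ⟨_, rfl⟩
  refine hj ?_
  rw [hH j]
  refine ComputablePred.rice S hS (hphi i) (hphi j) ?_
  rw [hH i] at hi
  exact hi

/-! ### Sets generated by computably enumerable rules -/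

section Derivable

variable {J : Type}

/-- The set generated by the rules `step`, where `step (j, l)` says that `j` may be inferred from
the list `l` of premises. -/
inductive Derivable (step : J × List J → Prop) : J → Prop
  | intro (j : J) (l : List J) : step (j, l) → (∀ i ∈ l, Derivable step i) → Derivable step j

/-- One move of the proof checker: replace the first goal by the premises `x.1` of a rule, if `q`
confirms with the witness `x.2` that this is a rule. -/
def checkerMove (q : (J × List J) × ℕ → Bool) (goals : List J) (x : List J × ℕ) : List J :=
  List.casesOn goals [] fun j rest => bif q ((j, x.1), x.2) then x.1 ++ rest else j :: rest

/-- A derivation is a script of moves with which the checker gets rid of all its goals. -/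
theorem derivable_iff_exists_script {step : J × List J → Prop} {q : (J × List J) × ℕ → Bool}
    (hq : ∀ y, step y ↔ ∃ n, q (y, n) = true) (j : J) :
    Derivable step j ↔ ∃ c : List (List J × ℕ), c.foldl (checkerMove q) [j] = [] := by
  constructor
  · intro h
    have key : ∃ c : List (List J × ℕ), ∀ rest, c.foldl (checkerMove q) (j :: rest) = rest := by
      induction h with
      | intro j l hl _ ih =>
        obtain ⟨n, hn⟩ := (hq _).1 hl
        have : ∀ l' : List J, (∀ i ∈ l', ∃ c : List (List J × ℕ), ∀ rest,
            c.foldl (checkerMove q) (i :: rest) = rest) → ∃ c : List (List J × ℕ), ∀ rest,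
            c.foldl (checkerMove q) (l' ++ rest) = rest := by
          intro l'
          induction l' with
          | nil => exact fun _ => ⟨[], fun rest => rfl⟩
          | cons i l' ih' =>
            intro h
            obtain ⟨c, hc⟩ := h i (by simp)
            obtain ⟨d, hd⟩ := ih' fun k hk => h k (by simp [hk])
            exact ⟨c ++ d, fun rest => by
              rw [List.foldl_append, List.cons_append, hc, hd]⟩
        obtain ⟨c, hc⟩ := this l ih
        refine ⟨(l, n) :: c, fun rest => ?_⟩
        rw [List.foldl_cons, checkerMove]
        simp only [hn, cond_true]
        exact hc rest
    obtain ⟨c, hc⟩ := key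
    exact ⟨c, hc []⟩
  · rintro ⟨c, hc⟩
    have key : ∀ (c : List (List J × ℕ)) (goals : List J), c.foldl (checkerMove q) goals = [] →
        ∀ i ∈ goals, Derivable step i := by
      intro c
      induction c with
      | nil =>
        intro goals h i hi
        have : goals = [] := h
        simp [this] at hi
      | cons x c ih =>
        intro goals h i hi
        have h' := ih _ h
        cases goals with
        | nil => simp at hi
        | cons j rest =>
          simp only [checkerMove] at h'
          cases hx : q ((j, x.1), x.2) with
          | false =>
            rw [hx] at h'
            exact h' i hi
          | true =>
            rw [hx] at h'
            simp only [cond_true, List.mem_append] at h'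
            rcases List.mem_cons.1 hi with rfl | hi
            · exact .intro _ _ ((hq _).2 ⟨_, hx⟩) fun k hk => h' k (.inl hk)
            · exact h' i (.inr hi)
    exact key c _ hc j (by simp)

theorem REPred.derivable [Primcodable J] {step : J × List J → Prop} (h : REPred step) :
    REPred (Derivable step) := by
  classical
  obtain ⟨q, hq, hqs⟩ := rePred_iff_primrec.1 h
  have hmove : Primrec₂ (checkerMove q) := by
    refine Primrec.list_casesOn (α := List J × (List J × ℕ)) (f := fun y => y.1)
      (g := fun _ => ([] : List J)) (h := fun y z => bif q ((z.1, y.2.1), y.2.2)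
        then y.2.1 ++ z.2 else z.1 :: z.2) Primrec.fst (Primrec.const []) ?_
    refine Primrec.to₂ (Primrec.cond (hq.comp (((Primrec.fst.comp Primrec.snd).pair
      (Primrec.fst.comp (Primrec.snd.comp Primrec.fst))).pair
      (Primrec.snd.comp (Primrec.snd.comp Primrec.fst))))
      (Primrec.list_append.comp (Primrec.fst.comp (Primrec.snd.comp Primrec.fst))
        (Primrec.snd.comp Primrec.snd))
      (Primrec.list_cons.comp (Primrec.fst.comp Primrec.snd) (Primrec.snd.comp Primrec.snd)))
  have hrun : Primrec fun x : J × List (List J × ℕ) => x.2.foldl (checkerMove q) [x.1] :=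
    Primrec.list_foldl Primrec.snd (Primrec.list_cons.comp Primrec.fst (Primrec.const []))
      (hmove.comp (Primrec.fst.comp Primrec.snd) (Primrec.snd.comp Primrec.snd)).to₂
  have hcheck := hrun.to_comp.decide_eq (Computable.const (α := J × List (List J × ℕ)) [])
  refine (REPred.exists_snd (REPred.of_computable hcheck)).of_eq fun j => ?_
  rw [derivable_iff_exists_script hqs]
  simp

end Derivable

/-! ### A numbering of the formulas of set theory -/

namespace SetFormula

/-- Gödel numbers of set-theoretical formulas; every natural number is the number of a formula. -/
def toNat : SetFormula → ℕ
  | bot => 0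
  | mem x y => 4 * Nat.pair x y + 1
  | eq x y => 4 * Nat.pair x y + 2
  | imp φ ψ => 4 * Nat.pair φ.toNat ψ.toNat + 3
  | all φ => 4 * φ.toNat + 4

theorem toNat_injective : Function.Injective toNat := by
  intro φ
  induction φ with
  | mem x y => intro ψ h; cases ψ <;> simp [toNat] at h ⊢ <;> omega
  | eq x y => intro ψ h; cases ψ <;> simp [toNat] at h ⊢ <;> omega
  | bot => intro ψ h; cases ψ <;> simp [toNat] at h ⊢
  | imp φ φ' ih ih' =>
    intro ψ h
    cases ψ <;> simp [toNat] at h ⊢ <;> first | omega | exact ⟨ih h.1, ih' h.2⟩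
  | all φ ih => intro ψ h; cases ψ <;> simp [toNat] at h ⊢ <;> first | omega | exact ih h

theorem toNat_surjective : Function.Surjective toNat := by
  intro n
  induction n using Nat.strong_induction_on with
  | _ n ih =>
    obtain rfl | hn := Nat.eq_zero_or_pos n
    · exact ⟨bot, rfl⟩
    obtain ⟨m, r, hr, hmr⟩ : ∃ m r, r < 4 ∧ n = 4 * m + r + 1 :=
      ⟨(n - 1) / 4, (n - 1) % 4, by omega, by omega⟩
    have h1 := Nat.unpair_left_le m
    have h2 := Nat.unpair_right_le m
    have h3 := Nat.pair_unpair m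
    obtain ⟨φ, hφ⟩ := ih m.unpair.1 (by omega)
    obtain ⟨ψ, hψ⟩ := ih m.unpair.2 (by omega)
    obtain ⟨χ, hχ⟩ := ih m (by omega)
    interval_cases r
    · exact ⟨mem m.unpair.1 m.unpair.2, by simp [toNat, hmr]⟩
    · exact ⟨eq m.unpair.1 m.unpair.2, by simp [toNat, hmr]⟩
    · exact ⟨imp φ ψ, by simp [toNat, hmr, hφ, hψ]⟩
    · exact ⟨all χ, by simp [toNat, hmr, hχ]⟩

/-- The numbering of formulas by `toNat`, used for the computability of functions on formulas. -/
noncomputable instance : Denumerable SetFormula :=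
  Denumerable.mk' (Equiv.ofBijective toNat ⟨toNat_injective, toNat_surjective⟩)

theorem encode_eq (φ : SetFormula) : Encodable.encode φ = φ.toNat := rfl

section Computable

variable {α : Type} [Primcodable α] {f g h : α → ℕ} {F G : α → SetFormula}

@[fun_prop]
theorem computable_mem (hf : Computable f) (hg : Computable g) :
    Computable fun a => mem (f a) (g a) :=
  Computable.encode_iff.1 (by simp only [encode_eq, toNat]; fun_prop)

@[fun_prop]
theorem computable_eq (hf : Computable f) (hg : Computable g) :
    Computable fun a => eq (f a) (g a) :=
  Computable.encode_iff.1 (by simp only [encode_eq, toNat]; fun_prop)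

@[fun_prop]
theorem computable_imp (hF : Computable F) (hG : Computable G) :
    Computable fun a => imp (F a) (G a) :=
  Computable.encode_iff.1 (by simp only [encode_eq, toNat]; simp only [← encode_eq]; fun_prop)

@[fun_prop]
theorem computable_all (hF : Computable F) : Computable fun a => all (F a) :=
  Computable.encode_iff.1 (by simp only [encode_eq, toNat]; simp only [← encode_eq]; fun_prop)

@[fun_prop]
theorem computable_neg (hF : Computable F) : Computable fun a => neg (F a) := by
  unfold neg; fun_prop

@[fun_prop]
theorem computable_conj (hF : Computable F) (hG : Computable G) :
    Computable fun a => conj (F a) (G a) := by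
  unfold conj; fun_prop

@[fun_prop]
theorem computable_disj (hF : Computable F) (hG : Computable G) :
    Computable fun a => disj (F a) (G a) := by
  unfold disj; fun_prop

@[fun_prop]
theorem computable_biimp (hF : Computable F) (hG : Computable G) :
    Computable fun a => biimp (F a) (G a) := by
  unfold biimp; fun_prop

@[fun_prop]
theorem computable_ex (hF : Computable F) : Computable fun a => ex (F a) := by
  unfold ex; fun_prop

@[fun_prop]
theorem computable_isEmpty (hf : Computable f) : Computable fun a => isEmpty (f a) := by
  unfold isEmpty; fun_prop

@[fun_prop]
theorem computable_isSucc (hf : Computable f) (hg : Computable g) :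
    Computable fun a => isSucc (f a) (g a) := by
  unfold isSucc; fun_prop

@[fun_prop]
theorem computable_isPair (hf : Computable f) (hg : Computable g) (hh : Computable h) :
    Computable fun a => isPair (f a) (g a) (h a) := by
  unfold isPair; fun_prop

@[fun_prop]
theorem computable_isOrdPair (hf : Computable f) (hg : Computable g) (hh : Computable h) :
    Computable fun a => isOrdPair (f a) (g a) (h a) := by
  unfold isOrdPair; fun_prop

@[fun_prop]
theorem computable_pairMem (hf : Computable f) (hg : Computable g) (hh : Computable h) :
    Computable fun a => pairMem (f a) (g a) (h a) := by
  unfold pairMem; fun_prop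

@[fun_prop]
theorem computable_isSum (hf : Computable f) (hg : Computable g) (hh : Computable h) :
    Computable fun a => isSum (f a) (g a) (h a) := by
  unfold isSum; fun_prop

@[fun_prop]
theorem computable_isProd (hf : Computable f) (hg : Computable g) (hh : Computable h) :
    Computable fun a => isProd (f a) (g a) (h a) := by
  unfold isProd; fun_prop

end Computable

/-! ### Renamings -/

/-- The renaming that is given by a list of values for the first variables, and shifts all other
variables by a constant. -/
def renamingOf (r : List ℕ × ℕ) (n : ℕ) : ℕ := (r.1[n]?).getD (n - r.1.length + r.2)

/-- The extension of a renaming to the scope of a quantifier. -/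
def upRenaming (r : List ℕ × ℕ) : List ℕ × ℕ := (0 :: r.1.map Nat.succ, r.2 + 1)

theorem up_renaming (r : List ℕ × ℕ) : up (renamingOf r) = renamingOf (upRenaming r) := by
  funext n
  cases n with
  | zero => simp [up, renamingOf, upRenaming]
  | succ n =>
    simp only [up, renamingOf, upRenaming, List.getElem?_cons_succ, List.getElem?_map,
      List.length_cons, List.length_map]
    cases h : r.1[n]? with
    | none => simp; omega
    | some m => simp

@[fun_prop]
theorem computable_renaming {α : Type} [Primcodable α] {r : α → List ℕ × ℕ} {f : α → ℕ}
    (hr : Computable r) (hf : Computable f) : Computable fun a => renamingOf (r a) (f a) := by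
  unfold renamingOf
  exact Computable.option_getD (by fun_prop) (by fun_prop)

@[fun_prop]
theorem computable_upRenaming {α : Type} [Primcodable α] {r : α → List ℕ × ℕ}
    (hr : Computable r) : Computable fun a => upRenaming (r a) := by
  have : Computable fun l : List ℕ => l.map Nat.succ :=
    (Primrec.list_map Primrec.id (Primrec.succ.comp Primrec.snd).to₂).to_comp
  have h := this.comp (Computable.fst' hr)
  unfold upRenaming
  fun_prop

theorem renamingOf_nil_one : renamingOf ([], 1) = Nat.succ := by
  funext n
  simp [renamingOf]

theorem rename_singleton_zero (φ : SetFormula) (t : ℕ) :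
    φ.rename (renamingOf ([t], 0)) = φ.inst t := by
  unfold inst
  congr 1
  funext n
  cases n <;> simp [renamingOf]

end SetFormula

/-! ### The theorems of ZFC are computably enumerable -/

/-- The judgments of a calculus that generates the theorems of ZFC among the renderings of
arithmetical formulas. -/
abbrev Judgment : Type :=
  (List SetFormula × SetFormula) ⊕ ((List ℕ × ℕ) × List SetFormula × List SetFormula) ⊕
    (ℕ × SetFormula) ⊕ ((ℕ × ℕ × ℕ) × SetFormula)

namespace Judgment

open SetFormula

/-- The judgment that `φ` is derivable from the assumptions `Γ`. -/
abbrev der (Γ : List SetFormula) (φ : SetFormula) : Judgment := .inl (Γ, φ)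

/-- The judgment that the renaming `r` turns the formulas in `Γ` into those in `Δ`. -/
abbrev ren (r : List ℕ × ℕ) (Γ Δ : List SetFormula) : Judgment := .inr (.inl (r, Γ, Δ))

/-- The judgment that `φ` renders the arithmetical formula with the Gödel number `n`. -/
abbrev rendering (n : ℕ) (φ : SetFormula) : Judgment := .inr (.inr (.inl (n, φ)))

/-- The judgment that `φ` is the formula `t.graph k z` for the term `t` with the Gödel number
`n`. -/
abbrev termGraph (n k z : ℕ) (φ : SetFormula) : Judgment := .inr (.inr (.inr ((n, k, z), φ)))

/-- What the judgments say. -/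
def Valid : Judgment → Prop
  | .inl (Γ, φ) => ZFCDerives Γ φ
  | .inr (.inl (r, Γ, Δ)) => Δ = Γ.map (rename (renamingOf r))
  | .inr (.inr (.inl (n, φ))) => ∃ σ : ArithFormula, σ.code = n ∧ σ.toSet = φ
  | .inr (.inr (.inr ((n, k, z), φ))) => ∃ t : ArithTerm, t.code = n ∧ t.graph k z = φ

/-- The axioms of ZFC other than the instances of the two schemes. -/
def finiteAxioms : List SetFormula :=
  [all (all (imp (all (biimp (mem 0 2) (mem 0 1))) (eq 1 0))),
    all (imp (ex (mem 0 1)) (ex (conj (mem 0 1) (neg (ex (conj (mem 0 1) (mem 0 2))))))),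
    all (all (ex (isPair 0 2 1))),
    all (ex (all (biimp (mem 0 1) (ex (conj (mem 0 3) (mem 1 0)))))),
    all (ex (all (biimp (mem 0 1) (all (imp (mem 0 1) (mem 0 3)))))),
    ex (isInductive 0),
    all (imp
      (conj
        (all (imp (mem 0 1) (ex (mem 0 1))))
        (all (imp (mem 0 1) (all (imp (mem 0 2)
          (imp (ex (conj (mem 0 2) (mem 0 1))) (eq 1 0)))))))
      (ex (all (imp (mem 0 2) (ex (conj (mem 0 1) (conj (mem 0 2)
        (all (imp (conj (mem 0 2) (mem 0 3)) (eq 0 1))))))))))]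

theorem zfc_of_mem_finiteAxioms {φ : SetFormula} (h : φ ∈ finiteAxioms) : ZFC φ := by
  simp only [finiteAxioms, List.mem_cons, List.not_mem_nil, or_false] at h
  rcases h with rfl | rfl | rfl | rfl | rfl | rfl | rfl
  · exact .extensionality
  · exact .foundation
  · exact .pairing
  · exact .union
  · exact .powerset
  · exact .infinity
  · exact .choice

/-- The separation axiom, in terms of the renamed formula. -/
def separationAxiom (φ : SetFormula) : SetFormula :=
  all (ex (all (biimp (mem 0 1) (conj (mem 0 2) φ))))

/-- The replacement axiom, in terms of the renamed copies of the formula. -/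
def replacementAxiom (φ ψ χ : SetFormula) : SetFormula :=
  all (imp (all (imp (mem 0 1) (all (all (imp (conj φ ψ) (eq 1 0))))))
    (ex (all (biimp (mem 0 1) (ex (conj (mem 0 3) χ))))))

theorem renamingOf_separation : renamingOf ([0], 3) = fun | 0 => 0 | n + 1 => n + 3 := by
  funext n
  cases n <;> simp [renamingOf]

theorem renamingOf_replacement (a b : ℕ) :
    renamingOf ([a, b], 4) = fun | 0 => a | 1 => b | n + 2 => n + 4 := by
  funext n
  rcases n with _ | _ | n <;> simp [renamingOf]

theorem zfc_separationAxiom (φ : SetFormula) :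
    ZFC (separationAxiom (φ.rename (renamingOf ([0], 3)))) := by
  rw [renamingOf_separation]
  exact ZFC.separation φ

theorem zfc_replacementAxiom (φ : SetFormula) :
    ZFC (replacementAxiom (φ.rename (renamingOf ([2, 1], 4))) (φ.rename (renamingOf ([2, 0], 4)))
      (φ.rename (renamingOf ([0, 1], 4)))) := by
  simp only [renamingOf_replacement]
  exact ZFC.replacement φ

/-- The rules for derivability. -/
def derRule (y : Judgment × List Judgment) : Prop :=
  (∃ x : List SetFormula × ℕ, (der x.1 ((finiteAxioms[x.2]?).getD (eq 0 0)), []) = y) ∨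
  (∃ x : List SetFormula × SetFormula × SetFormula,
    (der x.1 (separationAxiom x.2.2), [ren ([0], 3) [x.2.1] [x.2.2]]) = y) ∨
  (∃ x : List SetFormula × SetFormula × SetFormula × SetFormula × SetFormula,
    (der x.1 (replacementAxiom x.2.2.1 x.2.2.2.1 x.2.2.2.2),
      [ren ([2, 1], 4) [x.2.1] [x.2.2.1], ren ([2, 0], 4) [x.2.1] [x.2.2.2.1],
        ren ([0, 1], 4) [x.2.1] [x.2.2.2.2]]) = y) ∨
  (∃ x : List SetFormula × SetFormula × List SetFormula,
    (der (x.1 ++ x.2.1 :: x.2.2) x.2.1, []) = y) ∨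
  (∃ x : List SetFormula × SetFormula × SetFormula,
    (der x.1 (imp x.2.1 x.2.2), [der (x.2.1 :: x.1) x.2.2]) = y) ∨
  (∃ x : List SetFormula × SetFormula × SetFormula,
    (der x.1 x.2.2, [der x.1 (imp x.2.1 x.2.2), der x.1 x.2.1]) = y) ∨
  (∃ x : List SetFormula × SetFormula, (der x.1 x.2, [der (neg x.2 :: x.1) bot]) = y) ∨
  (∃ x : List SetFormula × List SetFormula × SetFormula,
    (der x.1 (all x.2.2), [ren ([], 1) x.1 x.2.1, der x.2.1 x.2.2]) = y) ∨
  (∃ x : List SetFormula × SetFormula × SetFormula × ℕ,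
    (der x.1 x.2.2.1, [der x.1 (all x.2.1), ren ([x.2.2.2], 0) [x.2.1] [x.2.2.1]]) = y) ∨
  (∃ x : List SetFormula × ℕ, (der x.1 (eq x.2 x.2), []) = y) ∨
  (∃ x : List SetFormula × (SetFormula × SetFormula × SetFormula) × ℕ × ℕ,
    (der x.1 x.2.1.2.2, [der x.1 (eq x.2.2.1 x.2.2.2),
      ren ([x.2.2.1], 0) [x.2.1.1] [x.2.1.2.1], der x.1 x.2.1.2.1,
      ren ([x.2.2.2], 0) [x.2.1.1] [x.2.1.2.2]]) = y)

/-- The rules for renaming. -/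
def renRule (y : Judgment × List Judgment) : Prop :=
  (∃ r : List ℕ × ℕ, (ren r [] [], []) = y) ∨
  (∃ x : (List ℕ × ℕ) × (List SetFormula × List SetFormula) × ℕ × ℕ,
    (ren x.1 (mem x.2.2.1 x.2.2.2 :: x.2.1.1)
      (mem (renamingOf x.1 x.2.2.1) (renamingOf x.1 x.2.2.2) :: x.2.1.2),
      [ren x.1 x.2.1.1 x.2.1.2]) = y) ∨
  (∃ x : (List ℕ × ℕ) × (List SetFormula × List SetFormula) × ℕ × ℕ,
    (ren x.1 (eq x.2.2.1 x.2.2.2 :: x.2.1.1)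
      (eq (renamingOf x.1 x.2.2.1) (renamingOf x.1 x.2.2.2) :: x.2.1.2),
      [ren x.1 x.2.1.1 x.2.1.2]) = y) ∨
  (∃ x : (List ℕ × ℕ) × List SetFormula × List SetFormula,
    (ren x.1 (bot :: x.2.1) (bot :: x.2.2), [ren x.1 x.2.1 x.2.2]) = y) ∨
  (∃ x : (List ℕ × ℕ) × (List SetFormula × List SetFormula) × (SetFormula × SetFormula) ×
      (SetFormula × SetFormula),
    (ren x.1 (imp x.2.2.1.1 x.2.2.2.1 :: x.2.1.1) (imp x.2.2.1.2 x.2.2.2.2 :: x.2.1.2),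
      [ren x.1 [x.2.2.1.1] [x.2.2.1.2], ren x.1 [x.2.2.2.1] [x.2.2.2.2],
        ren x.1 x.2.1.1 x.2.1.2]) = y) ∨
  (∃ x : (List ℕ × ℕ) × (List SetFormula × List SetFormula) × SetFormula × SetFormula,
    (ren x.1 (all x.2.2.1 :: x.2.1.1) (all x.2.2.2 :: x.2.1.2),
      [ren (upRenaming x.1) [x.2.2.1] [x.2.2.2], ren x.1 x.2.1.1 x.2.1.2]) = y)

/-- The rules for the rendering of arithmetical formulas. -/
def renderingRule (y : Judgment × List Judgment) : Prop :=
  (∃ x : (ℕ × ℕ) × SetFormula × SetFormula,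
    (rendering (Nat.pair 0 (Nat.pair x.1.1 x.1.2)) (ex (conj x.2.1 x.2.2)),
      [termGraph x.1.1 1 0 x.2.1, termGraph x.1.2 1 0 x.2.2]) = y) ∨
  (∃ _x : ℕ, (rendering (Nat.pair 1 0) bot, []) = y) ∨
  (∃ x : (ℕ × ℕ) × SetFormula × SetFormula,
    (rendering (Nat.pair 2 (Nat.pair x.1.1 x.1.2)) (imp x.2.1 x.2.2),
      [rendering x.1.1 x.2.1, rendering x.1.2 x.2.2]) = y) ∨
  (∃ x : ℕ × SetFormula,
    (rendering (Nat.pair 3 x.1) (all (imp (isNat 0) x.2)), [rendering x.1 x.2]) = y)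

/-- The rules for the graphs of arithmetical terms. -/
def termGraphRule (y : Judgment × List Judgment) : Prop :=
  (∃ x : ℕ × ℕ × ℕ,
    (termGraph (Nat.pair 0 x.1) x.2.1 x.2.2 (eq x.2.2 (x.1 + x.2.1)), []) = y) ∨
  (∃ x : ℕ × ℕ, (termGraph (Nat.pair 1 0) x.1 x.2 (isEmpty x.2), []) = y) ∨
  (∃ x : (ℕ × ℕ × ℕ) × SetFormula,
    (termGraph (Nat.pair 2 x.1.1) x.1.2.1 x.1.2.2 (ex (conj x.2 (isSucc (x.1.2.2 + 1) 0))),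
      [termGraph x.1.1 (x.1.2.1 + 1) 0 x.2]) = y) ∨
  (∃ x : ((ℕ × ℕ) × ℕ × ℕ) × SetFormula × SetFormula,
    (termGraph (Nat.pair 3 (Nat.pair x.1.1.1 x.1.1.2)) x.1.2.1 x.1.2.2
      (ex (ex (conj x.2.1 (conj x.2.2 (isSum (x.1.2.2 + 2) 1 0))))),
      [termGraph x.1.1.1 (x.1.2.1 + 2) 1 x.2.1, termGraph x.1.1.2 (x.1.2.1 + 2) 0 x.2.2]) = y) ∨
  (∃ x : ((ℕ × ℕ) × ℕ × ℕ) × SetFormula × SetFormula,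
    (termGraph (Nat.pair 4 (Nat.pair x.1.1.1 x.1.1.2)) x.1.2.1 x.1.2.2
      (ex (ex (conj x.2.1 (conj x.2.2 (isProd (x.1.2.2 + 2) 1 0))))),
      [termGraph x.1.1.1 (x.1.2.1 + 2) 1 x.2.1, termGraph x.1.1.2 (x.1.2.1 + 2) 0 x.2.2]) = y)

/-- The rules of the calculus. -/
def rule (y : Judgment × List Judgment) : Prop :=
  derRule y ∨ renRule y ∨ renderingRule y ∨ termGraphRule y

theorem rePred_derRule : REPred derRule := by
  classical
  refine .or (.range ?_) (.or (.range ?_) (.or (.range ?_) (.or (.range ?_) (.or (.range ?_)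
    (.or (.range ?_) (.or (.range ?_) (.or (.range ?_) (.or (.range ?_) (.or (.range ?_)
    (.range ?_)))))))))) <;> unfold der
  · have : Computable fun x : List SetFormula × ℕ => (finiteAxioms[x.2]?).getD (eq 0 0) :=
      Computable.option_getD (by fun_prop) (by fun_prop)
    fun_prop
  · unfold separationAxiom ren; fun_prop
  · unfold replacementAxiom ren; fun_prop
  · fun_prop
  · fun_prop
  · fun_prop
  · fun_prop
  · unfold ren; fun_prop
  · unfold ren; fun_prop
  · fun_prop
  · unfold ren; fun_prop

theorem rePred_renRule : REPred renRule := by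
  classical
  refine .or (.range ?_) (.or (.range ?_) (.or (.range ?_) (.or (.range ?_) (.or (.range ?_)
    (.range ?_))))) <;> unfold ren <;> fun_prop

theorem rePred_renderingRule : REPred renderingRule := by
  classical
  refine .or (.range ?_) (.or (.range ?_) (.or (.range ?_) (.range ?_))) <;>
    unfold rendering <;> (try unfold termGraph) <;> fun_prop

theorem rePred_termGraphRule : REPred termGraphRule := by
  classical
  refine .or (.range ?_) (.or (.range ?_) (.or (.range ?_) (.or (.range ?_) (.range ?_)))) <;>
    unfold termGraph <;> fun_prop

theorem rePred_rule : REPred rule :=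
  rePred_derRule.or (rePred_renRule.or (rePred_renderingRule.or rePred_termGraphRule))

theorem valid_of_derivable {j : Judgment} (h : Derivable rule j) : Valid j := by
  induction h with
  | intro j l hl _ ih =>
    rcases hl with hl | hl | hl | hl
    · rcases hl with ⟨⟨Γ, i⟩, hx⟩ | ⟨⟨Γ, φ, ψ⟩, hx⟩ | ⟨⟨Γ, φ, ψ, χ, θ⟩, hx⟩ | ⟨⟨Γ, φ, Δ⟩, hx⟩ |
        ⟨⟨Γ, φ, ψ⟩, hx⟩ | ⟨⟨Γ, φ, ψ⟩, hx⟩ | ⟨⟨Γ, φ⟩, hx⟩ | ⟨⟨Γ, Δ, φ⟩, hx⟩ | ⟨⟨Γ, φ, ψ, t⟩, hx⟩ |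
        ⟨⟨Γ, t⟩, hx⟩ | ⟨⟨Γ, ⟨φ, ψ, χ⟩, s, t⟩, hx⟩ <;> obtain ⟨rfl, rfl⟩ := Prod.mk.inj hx <;>
        simp only [List.forall_mem_cons, Valid, List.map_cons, List.map_nil, List.cons.injEq,
          and_true] at ih ⊢
      · cases hi : finiteAxioms[i]? with
        | none => exact .eqRefl 0
        | some φ => exact .ofZFC (zfc_of_mem_finiteAxioms (List.mem_of_getElem? hi))
      · rw [ih.1]
        exact .ofZFC (zfc_separationAxiom φ)
      · rw [ih.1, ih.2.1, ih.2.2.1]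
        exact .ofZFC (zfc_replacementAxiom φ)
      · exact .assumption (by simp)
      · exact .impIntro ih.1
      · exact .impElim ih.1 ih.2.1
      · exact .byContradiction ih.1
      · refine .allIntro ?_
        rw [renamingOf_nil_one] at ih
        have h := ih.2.1
        rw [ih.1] at h
        exact h
      · rw [ih.2.1, rename_singleton_zero]
        exact .allElim t ih.1
      · exact .eqRefl t
      · rw [rename_singleton_zero, rename_singleton_zero] at ih
        rw [ih.2.2.2.1]
        refine .eqSubst ih.1 ?_
        rw [← ih.2.1]
        exact ih.2.2.1
    · rcases hl with ⟨r, hx⟩ | ⟨⟨r, ⟨Γ, Δ⟩, a, b⟩, hx⟩ | ⟨⟨r, ⟨Γ, Δ⟩, a, b⟩, hx⟩ |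
        ⟨⟨r, Γ, Δ⟩, hx⟩ | ⟨⟨r, ⟨Γ, Δ⟩, ⟨φ, φ'⟩, ψ, ψ'⟩, hx⟩ | ⟨⟨r, ⟨Γ, Δ⟩, φ, φ'⟩, hx⟩ <;>
        obtain ⟨rfl, rfl⟩ := Prod.mk.inj hx <;>
        simp only [List.forall_mem_cons, Valid, List.map_cons, List.map_nil, List.cons.injEq,
          and_true, rename] at ih ⊢
      · simpa using ih.1
      · simpa using ih.1
      · simpa using ih.1
      · exact ⟨by rw [ih.1, ih.2.1], ih.2.2.1⟩
      · rw [up_renaming]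
        exact ⟨by rw [ih.1], ih.2.1⟩
    · rcases hl with ⟨⟨⟨s, t⟩, φ, ψ⟩, hx⟩ | ⟨_, hx⟩ | ⟨⟨⟨s, t⟩, φ, ψ⟩, hx⟩ | ⟨⟨n, φ⟩, hx⟩ <;>
        obtain ⟨rfl, rfl⟩ := Prod.mk.inj hx <;> simp only [List.forall_mem_cons, Valid] at ih ⊢
      · obtain ⟨⟨s, rfl, rfl⟩, ⟨t, rfl, rfl⟩, -⟩ := ih
        exact ⟨.eq s t, rfl, rfl⟩
      · exact ⟨.bot, rfl, rfl⟩
      · obtain ⟨⟨s, rfl, rfl⟩, ⟨t, rfl, rfl⟩, -⟩ := ih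
        exact ⟨.imp s t, rfl, rfl⟩
      · obtain ⟨⟨s, rfl, rfl⟩, -⟩ := ih
        exact ⟨.all s, rfl, rfl⟩
    · rcases hl with ⟨⟨n, k, z⟩, hx⟩ | ⟨⟨k, z⟩, hx⟩ | ⟨⟨⟨n, k, z⟩, φ⟩, hx⟩ |
        ⟨⟨⟨⟨m, n⟩, k, z⟩, φ, ψ⟩, hx⟩ | ⟨⟨⟨⟨m, n⟩, k, z⟩, φ, ψ⟩, hx⟩ <;>
        obtain ⟨rfl, rfl⟩ := Prod.mk.inj hx <;> simp only [List.forall_mem_cons, Valid] at ih ⊢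
      · exact ⟨.var n, rfl, rfl⟩
      · exact ⟨.zero, rfl, rfl⟩
      · obtain ⟨⟨s, rfl, rfl⟩, -⟩ := ih
        exact ⟨.succ s, rfl, rfl⟩
      · obtain ⟨⟨s, rfl, rfl⟩, ⟨t, rfl, rfl⟩, -⟩ := ih
        exact ⟨.add s t, rfl, rfl⟩
      · obtain ⟨⟨s, rfl, rfl⟩, ⟨t, rfl, rfl⟩, -⟩ := ih
        exact ⟨.mul s t, rfl, rfl⟩

theorem derivable_ren_cons (φ : SetFormula) : ∀ {r : List ℕ × ℕ} {Γ Δ : List SetFormula},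
    Derivable rule (ren r Γ Δ) →
      Derivable rule (ren r (φ :: Γ) (φ.rename (renamingOf r) :: Δ)) := by
  have hnil : ∀ r, Derivable rule (ren r [] []) := fun r =>
    .intro _ _ (.inr (.inl (.inl ⟨r, rfl⟩))) (by simp)
  induction φ with
  | mem a b =>
    intro r Γ Δ h
    exact .intro _ _ (.inr (.inl (.inr (.inl ⟨(r, (Γ, Δ), a, b), rfl⟩)))) (by simpa using h)
  | eq a b =>
    intro r Γ Δ h
    exact .intro _ _ (.inr (.inl (.inr (.inr (.inl ⟨(r, (Γ, Δ), a, b), rfl⟩)))))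
      (by simpa using h)
  | bot =>
    intro r Γ Δ h
    exact .intro _ _ (.inr (.inl (.inr (.inr (.inr (.inl ⟨(r, Γ, Δ), rfl⟩))))))
      (by simpa using h)
  | imp φ ψ ihφ ihψ =>
    intro r Γ Δ h
    refine .intro _ _ (.inr (.inl (.inr (.inr (.inr (.inr (.inl ⟨(r, (Γ, Δ),
      (φ, φ.rename (renamingOf r)), (ψ, ψ.rename (renamingOf r))), rfl⟩))))))) ?_
    simp only [List.forall_mem_cons]
    exact ⟨ihφ (hnil r), ihψ (hnil r), h, by simp⟩
  | all φ ih =>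
    intro r Γ Δ h
    refine .intro _ _ (.inr (.inl (.inr (.inr (.inr (.inr (.inr ⟨(r, (Γ, Δ), φ,
      φ.rename (up (renamingOf r))), rfl⟩))))))) ?_
    simp only [List.forall_mem_cons]
    rw [up_renaming]
    exact ⟨ih (hnil _), h, by simp⟩

theorem derivable_ren (r : List ℕ × ℕ) (Γ : List SetFormula) :
    Derivable rule (ren r Γ (Γ.map (rename (renamingOf r)))) := by
  induction Γ with
  | nil => exact .intro _ _ (.inr (.inl (.inl ⟨r, rfl⟩))) (by simp)
  | cons φ Γ ih => exact derivable_ren_cons φ ih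

theorem derivable_ren_inst (φ : SetFormula) (t : ℕ) :
    Derivable rule (ren ([t], 0) [φ] [φ.inst t]) := by
  rw [← rename_singleton_zero]
  exact derivable_ren _ [φ]

theorem derivable_finiteAxiom (Γ : List SetFormula) (i : ℕ) :
    Derivable rule (der Γ ((finiteAxioms[i]?).getD (eq 0 0))) :=
  .intro _ _ (.inl (.inl ⟨(Γ, i), rfl⟩)) (by simp)

theorem derivable_of_zfc {φ : SetFormula} (h : ZFC φ) (Γ : List SetFormula) :
    Derivable rule (der Γ φ) := by
  cases h with
  | extensionality => exact derivable_finiteAxiom Γ 0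
  | foundation => exact derivable_finiteAxiom Γ 1
  | pairing => exact derivable_finiteAxiom Γ 2
  | union => exact derivable_finiteAxiom Γ 3
  | powerset => exact derivable_finiteAxiom Γ 4
  | infinity => exact derivable_finiteAxiom Γ 5
  | choice => exact derivable_finiteAxiom Γ 6
  | separation φ =>
    refine .intro _ _ (.inl (.inr (.inl ⟨(Γ, φ, φ.rename fun | 0 => 0 | n + 1 => n + 3),
      rfl⟩))) ?_
    have := derivable_ren ([0], 3) [φ]
    rw [renamingOf_separation] at this
    simpa using this
  | replacement φ =>
    refine .intro _ _ (.inl (.inr (.inr (.inl ⟨(Γ, φ,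
      φ.rename fun | 0 => 2 | 1 => 1 | n + 2 => n + 4,
      φ.rename fun | 0 => 2 | 1 => 0 | n + 2 => n + 4,
      φ.rename fun | 0 => 0 | 1 => 1 | n + 2 => n + 4), rfl⟩)))) ?_
    have h1 := derivable_ren ([2, 1], 4) [φ]
    have h2 := derivable_ren ([2, 0], 4) [φ]
    have h3 := derivable_ren ([0, 1], 4) [φ]
    rw [renamingOf_replacement] at h1 h2 h3
    simp only [List.forall_mem_cons]
    exact ⟨h1, h2, h3, by simp⟩

theorem derivable_der {Γ : List SetFormula} {φ : SetFormula} (h : ZFCDerives Γ φ) :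
    Derivable rule (der Γ φ) := by
  induction h with
  | ofZFC h => exact derivable_of_zfc h _
  | @assumption Γ φ h =>
    obtain ⟨Δ, Θ, rfl⟩ := List.append_of_mem h
    exact .intro _ _ (.inl (.inr (.inr (.inr (.inl ⟨(Δ, φ, Θ), rfl⟩))))) (by simp)
  | @impIntro Γ φ ψ _ ih =>
    exact .intro _ _ (.inl (.inr (.inr (.inr (.inr (.inl ⟨(Γ, φ, ψ), rfl⟩)))))) (by simpa using ih)
  | @impElim Γ φ ψ _ _ ih ih' =>
    refine .intro _ _ (.inl (.inr (.inr (.inr (.inr (.inr (.inl ⟨(Γ, φ, ψ), rfl⟩))))))) ?_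
    simp only [List.forall_mem_cons]
    exact ⟨ih, ih', by simp⟩
  | @byContradiction Γ φ _ ih =>
    exact .intro _ _ (.inl (.inr (.inr (.inr (.inr (.inr (.inr (.inl ⟨(Γ, φ), rfl⟩))))))))
      (by simpa using ih)
  | @allIntro Γ φ _ ih =>
    refine .intro _ _ (.inl (.inr (.inr (.inr (.inr (.inr (.inr (.inr (.inl
      ⟨(Γ, Γ.map shift, φ), rfl⟩))))))))) ?_
    have h := derivable_ren ([], 1) Γ
    rw [renamingOf_nil_one] at h
    simp only [List.forall_mem_cons]
    exact ⟨h, ih, by simp⟩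
  | @allElim Γ φ t _ ih =>
    refine .intro _ _ (.inl (.inr (.inr (.inr (.inr (.inr (.inr (.inr (.inr (.inl
      ⟨(Γ, φ, φ.inst t, t), rfl⟩)))))))))) ?_
    simp only [List.forall_mem_cons]
    exact ⟨ih, derivable_ren_inst φ t, by simp⟩
  | @eqRefl Γ t =>
    exact .intro _ _ (.inl (.inr (.inr (.inr (.inr (.inr (.inr (.inr (.inr (.inr (.inl
      ⟨(Γ, t), rfl⟩))))))))))) (by simp)
  | @eqSubst Γ φ s t _ _ ih ih' =>
    refine .intro _ _ (.inl (.inr (.inr (.inr (.inr (.inr (.inr (.inr (.inr (.inr (.inr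
      ⟨(Γ, (φ, φ.inst s, φ.inst t), s, t), rfl⟩))))))))))) ?_
    simp only [List.forall_mem_cons]
    exact ⟨ih, derivable_ren_inst φ s, ih', derivable_ren_inst φ t, by simp⟩

theorem derivable_termGraph (t : ArithTerm) :
    ∀ k z, Derivable rule (termGraph t.code k z (t.graph k z)) := by
  induction t with
  | var n =>
    intro k z
    exact .intro _ _ (.inr (.inr (.inr (.inl ⟨(n, k, z), rfl⟩)))) (by simp)
  | zero =>
    intro k z
    exact .intro _ _ (.inr (.inr (.inr (.inr (.inl ⟨(k, z), rfl⟩))))) (by simp)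
  | succ t ih =>
    intro k z
    exact .intro _ _ (.inr (.inr (.inr (.inr (.inr (.inl
      ⟨((t.code, k, z), t.graph (k + 1) 0), rfl⟩)))))) (by simpa using ih _ _)
  | add s t ihs iht =>
    intro k z
    refine .intro _ _ (.inr (.inr (.inr (.inr (.inr (.inr (.inl
      ⟨(((s.code, t.code), k, z), s.graph (k + 2) 1, t.graph (k + 2) 0), rfl⟩))))))) ?_
    simp only [List.forall_mem_cons]
    exact ⟨ihs _ _, iht _ _, by simp⟩
  | mul s t ihs iht =>
    intro k z
    refine .intro _ _ (.inr (.inr (.inr (.inr (.inr (.inr (.inr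
      ⟨(((s.code, t.code), k, z), s.graph (k + 2) 1, t.graph (k + 2) 0), rfl⟩))))))) ?_
    simp only [List.forall_mem_cons]
    exact ⟨ihs _ _, iht _ _, by simp⟩

theorem derivable_rendering (σ : ArithFormula) :
    Derivable rule (rendering σ.code σ.toSet) := by
  induction σ with
  | eq s t =>
    refine .intro _ _ (.inr (.inr (.inl (.inl
      ⟨((s.code, t.code), s.graph 1 0, t.graph 1 0), rfl⟩)))) ?_
    simp only [List.forall_mem_cons]
    exact ⟨derivable_termGraph s _ _, derivable_termGraph t _ _, by simp⟩
  | bot => exact .intro _ _ (.inr (.inr (.inl (.inr (.inl ⟨0, rfl⟩))))) (by simp)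
  | imp σ τ ihσ ihτ =>
    refine .intro _ _ (.inr (.inr (.inl (.inr (.inr (.inl
      ⟨((σ.code, τ.code), σ.toSet, τ.toSet), rfl⟩)))))) ?_
    simp only [List.forall_mem_cons]
    exact ⟨ihσ, ihτ, by simp⟩
  | all σ ih =>
    exact .intro _ _ (.inr (.inr (.inl (.inr (.inr (.inr ⟨(σ.code, σ.toSet), rfl⟩))))))
      (by simpa using ih)

end Judgment

open Judgment in
/-- For a computable sequence of arithmetical formulas, those whose renderings are mapped by `F` to
theorems of ZFC can be enumerated. -/
theorem rePred_zfcProves {Y : ℕ → ArithFormula} (hY : Computable fun i => (Y i).code)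
    {F : SetFormula → SetFormula} (hF : Computable F) :
    REPred fun i => ZFCProves (F (Y i).toSet) := by
  have hY' : Computable fun x : ℕ × SetFormula => (Y x.1).code := hY.comp Computable.fst
  have h : REPred fun x : ℕ × SetFormula =>
      Derivable rule (rendering (Y x.1).code x.2) ∧ Derivable rule (der [] (F x.2)) :=
    (rePred_rule.derivable.comp (f := fun x : ℕ × SetFormula => rendering (Y x.1).code x.2)
      (by unfold rendering; fun_prop)).and
    (rePred_rule.derivable.comp (f := fun x : ℕ × SetFormula => der [] (F x.2))
      (by unfold der; fun_prop))
  refine h.exists_snd.of_eq fun i => ⟨?_, fun hi => ?_⟩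
  · rintro ⟨φ, h1, h2⟩
    obtain ⟨σ, hσ, rfl⟩ := valid_of_derivable h1
    rw [← ArithFormula.code_injective hσ]
    exact valid_of_derivable h2
  · exact ⟨_, derivable_rendering _, derivable_der hi⟩

/-! ### Independence -/

/-- If almost all of the statements were decided by ZFC, then searching for proofs and refutations
would solve the learnability decision problem. -/
theorem ExpressesLearnability.infinite_independent {L : Set Hypothesis → Prop}
    {H : ℕ → Set Hypothesis} {Y : ℕ → ArithFormula} (hY : ExpressesLearnability L H Y)
    (hZ : ZFCArithmeticallySound) (hL : ¬ LearnabilitySolvable L H) :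
    {i | IndependentOfZFC (Y i)}.Infinite := by
  classical
  intro hfin
  have hfinite : ∀ s : Finset ℕ, REPred fun i => i ∈ s := fun s =>
    (PrimrecPred.computablePred (by
      induction s using Finset.induction_on with
      | empty =>
        simp only [Finset.notMem_empty]
        exact ⟨fun _ => .isFalse id, Primrec.const false⟩
      | insert a s ha ih =>
        simp only [Finset.mem_insert]
        exact (Primrec.eq.comp Primrec.id (Primrec.const a)).or ih)).to_re
  have htrue : ∀ i, ZFCProves (Y i).toSet → L (H i) := fun i h =>
    (hY.2 i).2.1 (hZ _ (hY.2 i).1 h)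
  have hfalse : ∀ i, ZFCProves (Y i).toSet.neg → ¬ L (H i) := fun i h hLi =>
    hZ ((Y i).imp .bot) ⟨(hY.2 i).1, trivial⟩ h (fun _ => 0) ((hY.2 i).2.2 hLi _)
  refine hL (ComputablePred.computable_iff_re_compl_re.2 ⟨?_, ?_⟩)
  · refine ((rePred_zfcProves hY.1 Computable.id).or
      (hfinite (hfin.toFinset.filter fun i => L (H i)))).of_eq fun i => ?_
    simp only [Finset.mem_filter, Set.Finite.mem_toFinset, Set.mem_ofPred_eq, IndependentOfZFC]
    have := htrue i
    have := hfalse i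
    simp only [id]
    tauto
  · refine ((rePred_zfcProves hY.1 (F := SetFormula.neg) (by fun_prop)).or
      (hfinite (hfin.toFinset.filter fun i => ¬ L (H i)))).of_eq fun i => ?_
    simp only [Finset.mem_filter, Set.Finite.mem_toFinset, Set.mem_ofPred_eq, IndependentOfZFC]
    have := htrue i
    have := hfalse i
    tauto

/-! ### Finitely supported distributions -/

section Uniform

variable {α : Type} [MeasurableSpace α]

/-- The uniform distribution on the positions of the list `T`. These are the distributions with
finite support and rational weights. -/
noncomputable def listMeasure (T : List α) : Measure α :=
  Measure.map T.get ((T.length : ENNReal)⁻¹ • Measure.count)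

theorem isProbabilityMeasure_inv_smul_count {n : ℕ} (hn : n ≠ 0) :
    IsProbabilityMeasure ((n : ENNReal)⁻¹ • (Measure.count : Measure (Fin n))) := by
  constructor
  simp [ENNReal.inv_mul_cancel (Nat.cast_ne_zero.2 hn) (ENNReal.natCast_ne_top _)]

theorem isProbabilityMeasure_listMeasure {T : List α} (hT : T ≠ []) :
    IsProbabilityMeasure (listMeasure T) := by
  have := isProbabilityMeasure_inv_smul_count (n := T.length) (by simpa using hT)
  exact Measure.isProbabilityMeasure_map (by fun_prop)

theorem card_get_eq_countP {β : Type} (T : List β) (P : β → Bool) :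
    Nat.card {i : Fin T.length // P (T.get i)} = T.countP P := by
  rw [Nat.card_eq_fintype_card, Fintype.card_subtype, Finset.card_filter]
  induction T with
  | nil => simp
  | cons a T ih =>
    refine (Fin.sum_univ_succ _).trans ?_
    rw [List.countP_cons, add_comm, ← ih]
    rfl

variable [Countable α] [MeasurableSingletonClass α]

theorem listMeasure_real (T : List α) (P : α → Bool) :
    (listMeasure T).real {p | P p} = T.countP P / T.length := by
  rw [listMeasure, measureReal_def,
    Measure.map_apply (by fun_prop) (Set.to_countable _).measurableSet, Measure.smul_apply,
    Measure.count_apply_finite _ (Set.toFinite _), smul_eq_mul, ENNReal.toReal_mul,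
    ENNReal.toReal_inv, ENNReal.toReal_natCast, ENNReal.toReal_natCast, ← div_eq_inv_mul,
    ← Nat.card_eq_card_finite_toFinset, ← card_get_eq_countP]
  rfl

theorem listMeasure_real_singleton [DecidableEq α] (T : List α) (p : α) :
    (listMeasure T).real {p} = T.count p / T.length := by
  rw [List.count, ← listMeasure_real]
  congr 1
  ext q
  simp

theorem pi_listMeasure_real {T : List α} (hT : T ≠ []) (m : ℕ) (E : Set (Fin m → α)) :
    (Measure.pi fun _ : Fin m => listMeasure T).real E =
      Nat.card {u : Fin m → Fin T.length // T.get ∘ u ∈ E} / (T.length : ℝ) ^ m := by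
  have hn : T.length ≠ 0 := by simpa using hT
  have := isProbabilityMeasure_inv_smul_count hn
  have := isProbabilityMeasure_listMeasure hT
  have hpi : (Measure.pi fun _ : Fin m =>
      (T.length : ENNReal)⁻¹ • (Measure.count : Measure (Fin T.length))) =
      ((T.length : ENNReal)⁻¹ ^ m) • Measure.count := by
    refine Measure.ext_of_singleton fun u => ?_
    rw [Measure.pi_singleton]
    simp
  have hmap : (Measure.pi fun _ : Fin m => listMeasure T) =
      Measure.map (fun (u : Fin m → Fin T.length) i => T.get (u i))
        (((T.length : ENNReal)⁻¹ ^ m) • Measure.count) := by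
    rw [← hpi]
    have : SigmaFinite (Measure.map T.get ((T.length : ENNReal)⁻¹ • Measure.count)) :=
      (inferInstance : SigmaFinite (listMeasure T))
    exact (Measure.pi_map_pi (f := fun _ : Fin m => T.get)
      (μ := fun _ : Fin m => (T.length : ENNReal)⁻¹ • (Measure.count : Measure (Fin T.length)))
      fun _ => by fun_prop).symm
  rw [hmap, measureReal_def,
    Measure.map_apply (by fun_prop) (Set.to_countable _).measurableSet, Measure.smul_apply,
    Measure.count_apply_finite _ (Set.toFinite _), smul_eq_mul, ENNReal.toReal_mul,
    ENNReal.toReal_pow, ENNReal.toReal_inv, ENNReal.toReal_natCast, ENNReal.toReal_natCast,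
    inv_pow, ← div_eq_inv_mul, ← Nat.card_eq_card_finite_toFinset]
  rfl

end Uniform

/-! ### Approximation by finitely supported distributions -/

/-- A domination of point masses on `G` extends to all events, up to the mass outside `G`. -/
theorem measureReal_le_of_singleton_le {β : Type} [MeasurableSpace β] [MeasurableSingletonClass β]
    (μ ν : Measure β) [IsFiniteMeasure μ] [IsFiniteMeasure ν] {κ : ℝ} (hκ : 0 ≤ κ) {G : Set β}
    (hG : G.Finite) (h : ∀ x ∈ G, μ.real {x} ≤ κ * ν.real {x}) (E : Set β) :
    μ.real E ≤ κ * ν.real E + μ.real Gᶜ := by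
  have hfin : (E ∩ G).Finite := hG.inter_of_right E
  have h1 : ∀ ρ : Measure β, IsFiniteMeasure ρ →
      ρ.real (E ∩ G) = ∑ x ∈ hfin.toFinset, ρ.real {x} := fun ρ _ => by
    rw [sum_measureReal_singleton, Set.Finite.coe_toFinset]
  calc μ.real E ≤ μ.real ((E ∩ G) ∪ Gᶜ) := measureReal_mono (fun x hx => by
        by_cases hxG : x ∈ G
        · exact .inl ⟨hx, hxG⟩
        · exact .inr hxG)
    _ ≤ μ.real (E ∩ G) + μ.real Gᶜ := measureReal_union_le _ _
    _ ≤ κ * ν.real (E ∩ G) + μ.real Gᶜ := by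
        rw [h1 μ inferInstance, h1 ν inferInstance, Finset.mul_sum]
        gcongr with x hx
        exact h x (by simpa using (hfin.mem_toFinset.1 hx).2)
    _ ≤ κ * ν.real E + μ.real Gᶜ := by
        have : ν.real (E ∩ G) ≤ ν.real E := measureReal_mono Set.inter_subset_left
        gcongr

section Approximation

variable {α : Type} [MeasurableSpace α] [Countable α] [MeasurableSingletonClass α]

/-- A probability measure is dominated on a finite set `F` by a finitely supported distribution with
rational weights, up to a factor close to `1`: round up the multiples `n * D {p}` for a large
`n`. -/
theorem exists_list_dominating (D : Measure α) [IsProbabilityMeasure D] (F : Finset α)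
    (hF : 0 < D.real F) {κ : ℝ} (hκ : 1 < κ) :
    ∃ T : List α, T ≠ [] ∧ (∀ p ∈ T, p ∈ F) ∧
      ∀ p ∈ F, D.real {p} ≤ κ * (listMeasure T).real {p} := by
  classical
  obtain ⟨n, hn⟩ := exists_nat_gt (F.card / (κ - 1))
  have hn0 : (0 : ℝ) < n := lt_of_le_of_lt (div_nonneg (Nat.cast_nonneg _) (by linarith)) hn
  let c : α → ℕ := fun p => ⌈n * D.real {p}⌉₊
  let T : List α := F.toList.flatMap fun p => List.replicate (c p) p
  have hcount : ∀ p ∈ F, T.count p = c p := by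
    intro p hp
    simp only [T, List.count_flatMap, Function.comp_def, List.count_replicate]
    rw [Finset.sum_map_toList]
    simp [hp]
  have hlen : T.length = ∑ p ∈ F, c p := by
    simp [T, List.length_flatMap]
  have hsum : ∑ p ∈ F, D.real {p} = D.real F := sum_measureReal_singleton F
  have hge : n * D.real F ≤ T.length := by
    rw [hlen, ← hsum, Finset.mul_sum, Nat.cast_sum]
    exact Finset.sum_le_sum fun p _ => Nat.le_ceil _
  have hle : (T.length : ℝ) ≤ n * κ := by
    have h1 : (T.length : ℝ) ≤ ∑ p ∈ F, (n * D.real {p} + 1) := by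
      rw [hlen, Nat.cast_sum]
      exact Finset.sum_le_sum fun p _ => (Nat.ceil_lt_add_one (by positivity)).le
    rw [Finset.sum_add_distrib, ← Finset.mul_sum, hsum] at h1
    have h2 : D.real F ≤ 1 := measureReal_le_one
    have h3 := (div_lt_iff₀ (by linarith)).1 hn
    simp only [Finset.sum_const, nsmul_eq_mul, mul_one] at h1
    nlinarith
  have hpos : (0 : ℝ) < T.length := lt_of_lt_of_le (by positivity) hge
  refine ⟨T, fun h => by simp [h] at hpos, fun p hp => ?_, fun p hp => ?_⟩
  · obtain ⟨q, hq, hpq⟩ := List.mem_flatMap.1 hp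
    rw [(List.mem_replicate.1 hpq).2]
    simpa using hq
  · rw [listMeasure_real_singleton, hcount p hp, ← mul_div_assoc, le_div_iff₀ hpos]
    have h1 : n * D.real {p} ≤ c p := Nat.le_ceil _
    calc D.real {p} * T.length ≤ D.real {p} * (n * κ) := by gcongr
      _ = κ * (n * D.real {p}) := by ring
      _ ≤ κ * c p := by gcongr

/-- A probability measure that is concentrated on a finite set `F` up to an error `η` can be
approximated by a distribution that is supported on `F` and has rational weights, such that also
the `m`-fold powers are close. -/
theorem exists_list_approx (D : Measure α) [IsProbabilityMeasure D] (F : Finset α) {η τ : ℝ}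
    (hη : D.real (F : Set α)ᶜ ≤ η) (hη1 : η < 1) (hτ : 0 < τ) (m : ℕ) :
    ∃ T : List α, T ≠ [] ∧ (∀ p ∈ T, p ∈ F) ∧
      (∀ E, |D.real E - (listMeasure T).real E| ≤ η + τ) ∧
      ∀ E : Set (Fin m → α), (Measure.pi fun _ : Fin m => D).real E ≤
        (Measure.pi fun _ : Fin m => listMeasure T).real E + (m * η + τ) := by
  have hF : 0 < D.real F := by
    rw [probReal_compl_eq_one_sub F.measurableSet] at hη
    linarith
  obtain ⟨κ, hκ1, hκ, hκm⟩ : ∃ κ : ℝ, 1 < κ ∧ κ - 1 ≤ τ ∧ κ ^ m - 1 ≤ τ := by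
    have h1 : ∀ᶠ κ : ℝ in nhds 1, κ - 1 < τ :=
      (Continuous.tendsto (by fun_prop : Continuous fun κ : ℝ => κ - 1) 1).eventually_lt_const
        (by simpa using hτ)
    have h2 : ∀ᶠ κ : ℝ in nhds 1, κ ^ m - 1 < τ :=
      (Continuous.tendsto (by fun_prop : Continuous fun κ : ℝ => κ ^ m - 1) 1).eventually_lt_const
        (by simpa using hτ)
    have h3 : ∀ᶠ κ : ℝ in nhdsWithin 1 (Set.Ioi 1), 1 < κ := self_mem_nhdsWithin
    obtain ⟨κ, ⟨h1, h2⟩, h3⟩ :=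
      (((h1.and h2).filter_mono nhdsWithin_le_nhds).and h3).exists
    exact ⟨κ, h3, h1.le, h2.le⟩
  obtain ⟨T, hT, hTF, hdom⟩ := exists_list_dominating D F hF hκ1
  have := isProbabilityMeasure_listMeasure hT
  refine ⟨T, hT, hTF, ?_, fun E => ?_⟩
  · have key : ∀ E, D.real E ≤ (listMeasure T).real E + (η + τ) := fun E => by
      have h := measureReal_le_of_singleton_le D (listMeasure T) (κ := κ) (by linarith)
        F.finite_toSet hdom E
      have h1 : (listMeasure T).real E ≤ 1 := measureReal_le_one
      have h0 : 0 ≤ (listMeasure T).real E := measureReal_nonneg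
      nlinarith
    intro E
    have h1 := key E
    have h2 := key Eᶜ
    rw [probReal_compl_eq_one_sub (Set.to_countable E).measurableSet,
      probReal_compl_eq_one_sub (Set.to_countable E).measurableSet] at h2
    exact abs_le.2 ⟨by linarith, by linarith⟩
  · let G : Set (Fin m → α) := Set.univ.pi fun _ => (F : Set α)
    have hG : G.Finite := Set.Finite.pi fun _ => F.finite_toSet
    have h := measureReal_le_of_singleton_le (Measure.pi fun _ : Fin m => D)
      (Measure.pi fun _ : Fin m => listMeasure T) (κ := κ ^ m) (by positivity) hG
      (fun S hS => by
        simp only [measureReal_def, Measure.pi_singleton, ENNReal.toReal_prod]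
        calc ∏ i, (D {S i}).toReal ≤ ∏ i : Fin m, (κ * (listMeasure T {S i}).toReal) :=
              Finset.prod_le_prod (fun _ _ => ENNReal.toReal_nonneg)
                fun i _ => hdom _ (hS i trivial)
          _ = _ := by simp [Finset.prod_mul_distrib]) E
    have hGc : (Measure.pi fun _ : Fin m => D).real Gᶜ ≤ m * η := by
      have hsub : Gᶜ ⊆ ⋃ i : Fin m, (Function.eval i) ⁻¹' (F : Set α)ᶜ := by
        intro S hS
        simp only [G, Set.mem_compl_iff, Set.mem_univ_pi, not_forall] at hS
        simpa using hS
      calc _ ≤ _ := measureReal_mono hsub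
        _ ≤ ∑ i : Fin m, _ := measureReal_iUnion_fintype_le _
        _ = ∑ i : Fin m, D.real (F : Set α)ᶜ := by
          refine Finset.sum_congr rfl fun i _ => ?_
          exact (measurePreserving_eval (fun _ : Fin m => D) i).measureReal_preimage
            F.measurableSet.compl.nullMeasurableSet
        _ ≤ m * η := by
          simp only [Finset.sum_const, Finset.card_univ, Fintype.card_fin, nsmul_eq_mul]
          gcongr
    have h1 : (Measure.pi fun _ : Fin m => listMeasure T).real E ≤ 1 := measureReal_le_one
    have h0 : 0 ≤ (Measure.pi fun _ : Fin m => listMeasure T).real E := measureReal_nonneg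
    nlinarith

end Approximation

/-! ### Risks -/

theorem risk_nonneg (D : Measure (ℕ × Bool)) (h : Hypothesis) : 0 ≤ risk D h := measureReal_nonneg

theorem bddBelow_risk (D : Measure (ℕ × Bool)) (H : Set Hypothesis) :
    BddBelow (Set.range fun h : H => risk D h) :=
  ⟨0, by rintro _ ⟨h, rfl⟩; exact risk_nonneg D h⟩

theorem bestRisk_add_lt_iff {D : Measure (ℕ × Bool)} {H : Set Hypothesis} (hH : H.Nonempty)
    {ε x : ℝ} : bestRisk D H + ε < x ↔ ∃ h ∈ H, risk D h + ε < x := by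
  have := hH.to_subtype
  rw [← lt_sub_iff_add_lt, bestRisk, ciInf_lt_iff (bddBelow_risk D H)]
  simp only [Subtype.exists, exists_prop, lt_sub_iff_add_lt]

/-- The event that the learner `A` misses the optimal risk by more than `ε`. -/
def failureEvent (D : Measure (ℕ × Bool)) (H : Set Hypothesis) (A : Sample → Hypothesis) (ε : ℝ) :
    Set Sample :=
  {S | bestRisk D H + ε < risk D (A S)}

theorem mem_failureEvent {D : Measure (ℕ × Bool)} {H : Set Hypothesis} {A : Sample → Hypothesis}
    {ε : ℝ} {S : Sample} (hH : H.Nonempty) :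
    S ∈ failureEvent D H A ε ↔ ∃ h ∈ H, risk D h + ε < risk D (A S) := bestRisk_add_lt_iff hH

theorem failureEvent_subset {D D' : Measure (ℕ × Bool)} {H : Set Hypothesis} (hH : H.Nonempty)
    {A : Sample → Hypothesis} {ε ε' ζ : ℝ} (h : ∀ h, |risk D h - risk D' h| ≤ ζ)
    (hε : ε' + 2 * ζ ≤ ε) : failureEvent D H A ε ⊆ failureEvent D' H A ε' := by
  intro S hS
  obtain ⟨g, hg, hlt⟩ := (mem_failureEvent hH).1 hS
  refine (mem_failureEvent hH).2 ⟨g, hg, ?_⟩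
  have h1 := abs_le.1 (h g)
  have h2 := abs_le.1 (h (A S))
  linarith [h1.1, h2.2]

theorem sampleProb_mono {D : Measure (ℕ × Bool)} [IsProbabilityMeasure D] {m : ℕ}
    {E E' : Set Sample} (h : ∀ S ∈ E, S.length = m → S ∈ E') :
    sampleProb D m E ≤ sampleProb D m E' :=
  measureReal_mono fun S hS => h _ hS (by simp)

theorem sampleProb_risk_le (D : Measure (ℕ × Bool)) [IsProbabilityMeasure D] (m : ℕ)
    (H : Set Hypothesis) (A : Sample → Hypothesis) (ε : ℝ) :
    sampleProb D m {S | risk D (A S) ≤ bestRisk D H + ε} =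
      1 - sampleProb D m (failureEvent D H A ε) := by
  refine Eq.trans ?_ (probReal_compl_eq_one_sub (Set.to_countable _).measurableSet)
  unfold sampleProb
  congr 1
  ext S
  exact (not_lt (α := ℝ)).symm

/-- If a learner rarely fails for the distributions that are given by lists of points from the
finite set `F`, then this holds, up to small errors, for all distributions that are concentrated on
`F` up to a small error. -/
theorem sampleProb_failureEvent_le (D : Measure (ℕ × Bool)) [IsProbabilityMeasure D]
    {H : Set Hypothesis} (hH : H.Nonempty) (A : Sample → Hypothesis) (F : Finset (ℕ × Bool))
    {η ε ε' δ : ℝ} {m : ℕ} (hη : D.real (F : Set (ℕ × Bool))ᶜ ≤ η) (hη0 : 0 < η) (hη1 : η < 1)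
    (hε : ε' + 4 * η ≤ ε)
    (hA : ∀ T : List (ℕ × Bool), T ≠ [] → (∀ p ∈ T, p ∈ F) →
      sampleProb (listMeasure T) m (failureEvent (listMeasure T) H A ε') ≤ δ) :
    sampleProb D m (failureEvent D H A ε) ≤ δ + (m + 1) * η := by
  obtain ⟨T, hT, hTF, hclose, hpow⟩ := exists_list_approx D F hη hη1 hη0 m
  have := isProbabilityMeasure_listMeasure hT
  calc sampleProb D m (failureEvent D H A ε)
      ≤ sampleProb D m (failureEvent (listMeasure T) H A ε') :=
        sampleProb_mono fun S hS _ =>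
          failureEvent_subset hH (fun h => hclose _) (by linarith) hS
    _ ≤ sampleProb (listMeasure T) m (failureEvent (listMeasure T) H A ε') + (m * η + η) := hpow _
    _ ≤ δ + (m + 1) * η := by linarith [hA T hT hTF]

theorem exists_real_tail_le (D : Measure (ℕ × Bool)) [IsProbabilityMeasure D] {η : ℝ}
    (hη : 0 < η) : ∃ N : ℕ, D.real {p | N ≤ p.1} ≤ η := by
  have h : Filter.Tendsto (fun N : ℕ => D {p | N ≤ p.1}) Filter.atTop (nhds (D (⋂ N : ℕ,
      {p : ℕ × Bool | N ≤ p.1}))) :=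
    tendsto_measure_iInter_atTop (fun N => (Set.to_countable _).measurableSet.nullMeasurableSet)
      (fun M N hMN p hp => le_trans hMN hp) ⟨0, measure_ne_top _ _⟩
  have hempty : (⋂ N : ℕ, {p : ℕ × Bool | N ≤ p.1}) = ∅ := by
    ext p
    simp only [Set.mem_iInter, Set.mem_ofPred_eq, Set.mem_empty_iff_false, iff_false, not_forall]
    exact ⟨p.1 + 1, by omega⟩
  rw [hempty, measure_empty] at h
  obtain ⟨N, hN⟩ := (h.eventually_lt_const (ENNReal.ofReal_pos.2 hη)).exists
  exact ⟨N, ENNReal.toReal_le_of_le_ofReal hη.le hN.le⟩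

/-- The points with inputs smaller than `N`. -/
def pointsBelow (N : ℕ) : Finset (ℕ × Bool) := Finset.range N ×ˢ Finset.univ

theorem mem_pointsBelow {N : ℕ} {p : ℕ × Bool} : p ∈ pointsBelow N ↔ p.1 < N := by
  simp [pointsBelow]

theorem compl_pointsBelow (N : ℕ) : (pointsBelow N : Set (ℕ × Bool))ᶜ = {p | N ≤ p.1} := by
  ext p
  simp [mem_pointsBelow]

/-! ### Failure on finitely supported distributions -/

/-- The number of points in the list `T` on which the program `k`, run for `s` steps, does not yield
the right label. -/
def errCount (T : List (ℕ × Bool)) (k s : ℕ) : ℕ :=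
  T.countP fun p =>
    decide (Nat.Partrec.Code.evaln s (Denumerable.ofNat Nat.Partrec.Code k) p.1 ≠ some p.2.toNat)

/-- The program `k` has a risk larger by more than `1 / a` than the program `k'`, with respect to
the distribution given by `T`. The formulation is arithmetical: the error counts decrease with the
number of steps to their limits. -/
def Worse (a : ℕ) (T : List (ℕ × Bool)) (k k' : ℕ) : Prop :=
  ∃ s', ∀ s, a * errCount T k' s' + T.length < a * errCount T k s

theorem Computes.evaln_eq {k : ℕ} {h : Hypothesis} (hk : Computes k h) {s x y : ℕ}
    (hy : Nat.Partrec.Code.evaln s (Denumerable.ofNat Nat.Partrec.Code k) x = some y) :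
    y = (h x).toNat := by
  have h1 := Nat.Partrec.Code.evaln_sound hy
  have h2 := hk x
  unfold phi at h2
  rw [h2] at h1
  exact Part.mem_some_iff.1 h1

theorem Computes.le_errCount {k : ℕ} {h : Hypothesis} (hk : Computes k h) (T : List (ℕ × Bool))
    (s : ℕ) : (T.countP fun p => decide (h p.1 ≠ p.2)) ≤ errCount T k s := by
  refine List.countP_mono_left fun p _ hp => ?_
  simp only [decide_eq_true_eq] at hp ⊢
  intro hs
  have := hk.evaln_eq hs
  revert this hp
  cases h p.1 <;> cases p.2 <;> simp

theorem Computes.exists_errCount_eq {k : ℕ} {h : Hypothesis} (hk : Computes k h)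
    (T : List (ℕ × Bool)) :
    ∃ s, errCount T k s = T.countP fun p => decide (h p.1 ≠ p.2) := by
  -- a number of steps after which the program has halted on all inputs in `T`
  have hs : ∃ s, ∀ p ∈ T, Nat.Partrec.Code.evaln s (Denumerable.ofNat Nat.Partrec.Code k) p.1 =
      some (h p.1).toNat := by
    induction T with
    | nil => exact ⟨0, by simp⟩
    | cons p T ih =>
      obtain ⟨s, hs⟩ := ih
      have hp : (h p.1).toNat ∈ phi k p.1 := by
        rw [hk p.1]
        exact Part.mem_some _
      obtain ⟨s', hs'⟩ := Nat.Partrec.Code.evaln_complete.1 hp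
      refine ⟨max s s', fun q hq => ?_⟩
      rcases List.mem_cons.1 hq with rfl | hq
      · exact Nat.Partrec.Code.evaln_mono (le_max_right s s') hs'
      · exact Nat.Partrec.Code.evaln_mono (le_max_left s s') (hs q hq)
  obtain ⟨s, hs⟩ := hs
  refine ⟨s, List.countP_congr fun p hp => ?_⟩
  simp only [decide_eq_true_eq, hs p hp]
  cases h p.1 <;> cases p.2 <;> simp

theorem worse_iff {a : ℕ} (ha : 1 ≤ a) {T : List (ℕ × Bool)} (hT : T ≠ []) {k k' : ℕ}
    {h h' : Hypothesis} (hk : Computes k h) (hk' : Computes k' h') :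
    Worse a T k k' ↔ risk (listMeasure T) h' + 1 / a < risk (listMeasure T) h := by
  have hrisk : ∀ g : Hypothesis, risk (listMeasure T) g =
      (T.countP fun p => decide (g p.1 ≠ p.2) : ℕ) / T.length := fun g => by
    rw [← listMeasure_real]
    simp [risk]
  have h1 : Worse a T k k' ↔ a * (T.countP fun p => decide (h' p.1 ≠ p.2)) + T.length <
      a * T.countP fun p => decide (h p.1 ≠ p.2) := by
    constructor
    · rintro ⟨s', hs'⟩
      obtain ⟨s, hs⟩ := hk.exists_errCount_eq T
      have h1 := hs' s
      have h2 := Nat.mul_le_mul_left a (hk'.le_errCount T s')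
      rw [hs] at h1
      omega
    · intro hlt
      obtain ⟨s', hs'⟩ := hk'.exists_errCount_eq T
      refine ⟨s', fun s => ?_⟩
      have h2 := Nat.mul_le_mul_left a (hk.le_errCount T s)
      rw [hs']
      omega
  have hn : (0 : ℝ) < T.length := by
    exact_mod_cast List.length_pos_iff.2 hT
  have ha' : (0 : ℝ) < a := by exact_mod_cast ha
  rw [h1, hrisk, hrisk, div_add_div _ _ hn.ne' ha'.ne', div_lt_div_iff₀ (by positivity) hn,
    ← Nat.cast_lt (α := ℝ)]
  push_cast
  constructor
  · intro hlt
    nlinarith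
  · intro hlt
    have : (T.length : ℝ) * (a * (T.countP fun p => decide (h' p.1 ≠ p.2) : ℕ) + T.length) <
        T.length * (a * (T.countP fun p => decide (h p.1 ≠ p.2) : ℕ)) := by nlinarith
    exact lt_of_mul_lt_mul_left this hn.le

/-- On the sample `S`, the learner with the program `c` outputs a program that is worse by more than
`1 / a` than some program from the class represented by `e`. -/
def FailsOn (e c a : ℕ) (T : List (ℕ × Bool)) (S : Sample) : Prop :=
  ∃ k, k ∈ phi c (Encodable.encode S) ∧ ∃ k', k' ∈ W e ∧ Worse a T k k'

/-- The learner with the program `c` fails with a probability smaller than `1 / b` on samples of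
size `m` from the distribution given by `T`. The formulation is arithmetical: samples are drawn by
lists `u` of positions in `T`, and there are not too many different such lists for which the learner
fails. -/
def RarelyFails (e c a b m : ℕ) (T : List (ℕ × Bool)) : Prop :=
  ∀ U : List (List ℕ), U.Nodup →
    (∀ u ∈ U, (u.length = m ∧ ∀ j ∈ u, j < T.length) ∧
      FailsOn e c a T (u.map fun j => T.getD j (0, false))) →
    b * U.length < T.length ^ m

theorem IsRERIndex.failsOn_iff {e : ℕ} (he : IsRERIndex e) (hH : (hypClass e).Nonempty) {c a : ℕ}
    (ha : 1 ≤ a) {T : List (ℕ × Bool)} (hT : T ≠ []) {S : Sample} {A : Sample → Hypothesis}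
    (hS : ∃ k ∈ phi c (Encodable.encode S), Computes k (A S)) :
    FailsOn e c a T S ↔ S ∈ failureEvent (listMeasure T) (hypClass e) A (1 / a) := by
  obtain ⟨k, hk, hkA⟩ := hS
  rw [mem_failureEvent hH]
  constructor
  · rintro ⟨l, hl, k', hk', hw⟩
    rw [Part.mem_unique hl hk] at hw
    obtain ⟨h, hh⟩ := he k' hk'
    exact ⟨h, ⟨k', hk', hh⟩, (worse_iff ha hT hkA hh).1 hw⟩
  · rintro ⟨h, ⟨k', hk', hh⟩, hlt⟩
    exact ⟨k, hk, k', hk', (worse_iff ha hT hkA hh).2 hlt⟩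

theorem map_getD_ofFn {α : Type} (T : List α) (d : α) {m : ℕ} (u : Fin m → Fin T.length) :
    ((List.ofFn fun i => (u i : ℕ)).map fun j => T.getD j d) = List.ofFn (T.get ∘ u) := by
  rw [List.map_ofFn]
  congr 1
  funext i
  simp

/-- The lists of `m` numbers smaller than `n` correspond to the functions from `Fin m` to
`Fin n`. -/
theorem exists_ofFn_val_eq {m n : ℕ} {u : List ℕ} (hu : u.length = m) (h : ∀ j ∈ u, j < n) :
    ∃ f : Fin m → Fin n, (List.ofFn fun i => (f i : ℕ)) = u := by
  subst hu
  exact ⟨fun i => ⟨u.get i, h _ (List.get_mem u i)⟩, by simp⟩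

theorem rarelyFails_iff {e c a b m : ℕ} (hb : 1 ≤ b) {T : List (ℕ × Bool)} (hT : T ≠ [])
    {E : Set Sample} (hE : ∀ u : Fin m → Fin T.length,
      FailsOn e c a T (List.ofFn (T.get ∘ u)) ↔ List.ofFn (T.get ∘ u) ∈ E) :
    RarelyFails e c a b m T ↔ sampleProb (listMeasure T) m E < 1 / b := by
  classical
  let B : Finset (Fin m → Fin T.length) := Finset.univ.filter fun u => List.ofFn (T.get ∘ u) ∈ E
  let g : (Fin m → Fin T.length) → List ℕ := fun u => List.ofFn fun i => (u i : ℕ)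
  have hg : Function.Injective g := fun u v huv => by
    funext i
    exact Fin.ext (congrFun (List.ofFn_injective huv) i)
  have hprob : sampleProb (listMeasure T) m E = B.card / (T.length : ℝ) ^ m := by
    rw [sampleProb, pi_listMeasure_real hT, Nat.card_eq_fintype_card, Fintype.card_subtype]
    rfl
  have hn : (0 : ℝ) < T.length := by
    exact_mod_cast List.length_pos_iff.2 hT
  have hb' : (0 : ℝ) < b := by exact_mod_cast hb
  have h1 : sampleProb (listMeasure T) m E < 1 / b ↔ b * B.card < T.length ^ m := by
    rw [hprob, div_lt_div_iff₀ (by positivity) hb', one_mul, mul_comm,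
      ← Nat.cast_lt (α := ℝ)]
    push_cast
    rfl
  have hmem : ∀ u, u ∈ B.image g ↔ (u.length = m ∧ ∀ j ∈ u, j < T.length) ∧
      FailsOn e c a T (u.map fun j => T.getD j (0, false)) := by
    intro u
    constructor
    · intro hu
      obtain ⟨f, hf, rfl⟩ := Finset.mem_image.1 hu
      refine ⟨⟨by simp [g], by simp [g, List.mem_ofFn]⟩, ?_⟩
      rw [map_getD_ofFn, hE]
      exact (Finset.mem_filter.1 hf).2
    · rintro ⟨⟨hm, hu⟩, hf⟩
      obtain ⟨f, rfl⟩ := exists_ofFn_val_eq hm hu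
      rw [map_getD_ofFn, hE] at hf
      exact Finset.mem_image_of_mem g (Finset.mem_filter.2 ⟨Finset.mem_univ _, hf⟩)
  rw [h1]
  constructor
  · intro h
    have := h (B.image g).toList (Finset.nodup_toList _) fun u hu =>
      (hmem u).1 (Finset.mem_toList.1 hu)
    rwa [Finset.length_toList, Finset.card_image_of_injective _ hg] at this
  · intro h U hU hUf
    have h2 : U.toFinset ⊆ B.image g := fun u hu => (hmem u).2 (hUf u (List.mem_toFinset.1 hu))
    have h3 := Finset.card_le_card h2
    rw [Finset.card_image_of_injective _ hg, List.toFinset_card_of_nodup hU] at h3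
    exact lt_of_le_of_lt (Nat.mul_le_mul_left b h3) h

/-- The arithmetical formulation agrees with the probabilistic one, for a program `c` that
implements the learner `A` on the samples that can occur. -/
theorem IsRERIndex.rarelyFails_iff {e : ℕ} (he : IsRERIndex e) (hH : (hypClass e).Nonempty)
    {c a b m : ℕ} (ha : 1 ≤ a) (hb : 1 ≤ b) {T : List (ℕ × Bool)} (hT : T ≠ [])
    {A : Sample → Hypothesis} (hA : ∀ S : Sample, S.length = m → (∀ p ∈ S, p ∈ T) →
      ∃ k ∈ phi c (Encodable.encode S), Computes k (A S)) :
    RarelyFails e c a b m T ↔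
      sampleProb (listMeasure T) m (failureEvent (listMeasure T) (hypClass e) A (1 / a)) <
        1 / b := by
  refine _root_.rarelyFails_iff hb hT fun u => he.failsOn_iff hH ha hT (hA _ (by simp) ?_)
  simp [List.mem_ofFn]

/-! ### Strong computable PAC learnability -/

/-- An arithmetical formulation of strong computable PAC learnability of the class represented by
`e`, where `d` is a program for the sample complexity, and `c` is a program for the learner. -/
def SCPACCondition (e : ℕ) : Prop :=
  ∃ d c, (∀ a b, ∃ m, m ∈ phi d (Nat.pair a b)) ∧
    (∀ S : Sample, ∃ k, k ∈ phi c (Encodable.encode S) ∧ ∃ k', k' ∈ W e ∧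
      ∀ x, ∃ y, y ∈ phi k x ∧ y ∈ phi k' x) ∧
    ∀ a b m m', 1 ≤ a → 1 ≤ b → m' ∈ phi d (Nat.pair a b) → m' ≤ m →
      ∀ T : List (ℕ × Bool), T ≠ [] → RarelyFails e c a b m T

theorem Computes.congr {k k' : ℕ} {h : Hypothesis} (hk : Computes k' h)
    (hkk' : ∀ x, ∃ y, y ∈ phi k x ∧ y ∈ phi k' x) : Computes k h := fun x => by
  obtain ⟨y, hy, hy'⟩ := hkk' x
  rw [← hk x, Part.eq_some_iff.2 hy, Part.eq_some_iff.2 hy']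

theorem computable_of_forall_mem_phi {α : Type} [Primcodable α] {c : ℕ} {f : α → ℕ}
    (h : ∀ a, f a ∈ phi c (Encodable.encode a)) : Computable f :=
  Partrec.of_eq_tot (partrec_phi.comp (Computable.const c) Computable.encode) h

theorem exists_forall_mem_phi {α : Type} [Primcodable α] {f : α → ℕ} (hf : Computable f) :
    ∃ c, ∀ a, f a ∈ phi c (Encodable.encode a) := by
  obtain ⟨c, hc⟩ := Nat.Partrec.phi hf
  exact ⟨c, fun a => by rw [hc]; simp⟩

theorem exists_pointsBelow (D : Measure (ℕ × Bool)) [IsProbabilityMeasure D] {η : ℝ}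
    (hη : 0 < η) : ∃ N, D.real (pointsBelow N : Set (ℕ × Bool))ᶜ ≤ η := by
  obtain ⟨N, hN⟩ := exists_real_tail_le D hη
  exact ⟨N, by rwa [compl_pointsBelow]⟩

/-- An approximation error `η` that is negligible also after the multiplications that occur in
`sampleProb_failureEvent_le`. -/
theorem exists_small (a m : ℕ) {γ : ℝ} (hγ : 0 < γ) :
    ∃ η : ℝ, 0 < η ∧ η < 1 ∧ a * η ≤ γ ∧ (m + 1) * η < γ := by
  have hx : 0 < γ / (a + m + 2) := by positivity
  have hx' : (a + m + 2) * (γ / (a + m + 2)) = γ := mul_div_cancel₀ _ (by positivity)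
  have ha : 0 ≤ (a : ℝ) * (γ / (a + m + 2)) := by positivity
  have hm : 0 ≤ (m : ℝ) * (γ / (a + m + 2)) := by positivity
  refine ⟨min (1 / 2) (γ / (a + m + 2)), by positivity,
    lt_of_le_of_lt (min_le_left _ _) (by norm_num),
    (mul_le_mul_of_nonneg_left (min_le_right _ _) (by positivity)).trans ?_,
    (mul_le_mul_of_nonneg_left (min_le_right _ _) (by positivity)).trans_lt ?_⟩ <;> linarith

theorem SCPACCondition.scpacLearnable {e : ℕ} (he : IsRERIndex e) (h : SCPACCondition e) :
    SCPACLearnable (hypClass e) := by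
  obtain ⟨d, c, hd, hc, h⟩ := h
  choose s hs using hd
  choose k hk k' hk' hkk' using hc
  choose g hg using fun S => he (k' S) (hk' S)
  have hkg : ∀ S, Computes (k S) (g S) := fun S => (hg S).congr (hkk' S)
  have hmem : ∀ S, g S ∈ hypClass e := fun S => ⟨k' S, hk' S, hg S⟩
  have hH : (hypClass e).Nonempty := ⟨_, hmem []⟩
  have hsc : Computable fun x : ℕ × ℕ => s x.1 x.2 :=
    computable_of_forall_mem_phi (c := d) fun x => hs x.1 x.2
  -- the larger arguments leave room for the errors caused by the approximation of distributions
  refine ⟨fun a b => s (a + 1) (b + 1), g, ?_, ⟨k, computable_of_forall_mem_phi hk, hkg⟩, hmem, ?_⟩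
  · exact hsc.comp (f := fun x : ℕ × ℕ => s x.1 x.2) (g := fun x : ℕ × ℕ => (x.1 + 1, x.2 + 1))
      (by fun_prop)
  · intro a b ha hb m hm D hD
    have ha' : (0 : ℝ) < a := by exact_mod_cast ha
    have hb' : (0 : ℝ) < b := by exact_mod_cast hb
    -- the errors that the approximation of `D` may cause
    have hγa : (0 : ℝ) < 1 / a - 1 / (a + 1 : ℕ) :=
      sub_pos.2 (one_div_lt_one_div_of_lt ha' (by push_cast; linarith))
    have hγb : (0 : ℝ) < 1 / b - 1 / (b + 1 : ℕ) :=
      sub_pos.2 (one_div_lt_one_div_of_lt hb' (by push_cast; linarith))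
    obtain ⟨η, hη0, hη1, hη4, hηm⟩ := exists_small 4 m (lt_min hγa hγb)
    obtain ⟨N, hN⟩ := exists_pointsBelow D hη0
    have h4 := hη4.trans (min_le_left _ _)
    have h5 := hηm.trans_le (min_le_right _ _)
    have key := sampleProb_failureEvent_le D hH g (pointsBelow N) (ε := 1 / a)
      (ε' := 1 / (a + 1 : ℕ)) (δ := 1 / (b + 1 : ℕ)) (m := m) hN hη0 hη1
      (by push_cast at h4 ⊢; linarith)
      fun T hT _ => ((he.rarelyFails_iff hH (by omega) (by omega) hT
        fun S _ _ => ⟨k S, hk S, hkg S⟩).1 (h (a + 1) (b + 1) m _ (by omega) (by omega)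
          (hs _ _) hm T hT)).le
    exact lt_of_le_of_lt key (by linarith)

theorem SCPACLearnable.scpacCondition {e : ℕ} (he : IsRERIndex e)
    (h : SCPACLearnable (hypClass e)) : SCPACCondition e := by
  obtain ⟨s, A, hs, ⟨k, hk, hkA⟩, hA, h⟩ := h
  have hH : (hypClass e).Nonempty := ⟨_, hA []⟩
  obtain ⟨d, hd⟩ := exists_forall_mem_phi (f := fun x : ℕ × ℕ => s x.1 x.2) hs
  obtain ⟨c, hc⟩ := exists_forall_mem_phi hk
  refine ⟨d, c, fun a b => ⟨_, hd (a, b)⟩, fun S => ⟨_, hc S, ?_⟩, ?_⟩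
  · obtain ⟨k', hk', hk'A⟩ := hA S
    exact ⟨k', hk', fun x => ⟨(A S x).toNat, by simp [hkA S x], by simp [hk'A x]⟩⟩
  · intro a b m m' ha hb hm' hm T hT
    rw [Part.mem_unique hm' (hd (a, b))] at hm
    refine (he.rarelyFails_iff hH ha hb hT fun S _ _ => ⟨k S, hc S, hkA S⟩).2 ?_
    exact h a b ha hb m hm _ (isProbabilityMeasure_listMeasure hT)

/-! ### PAC learnability -/

/-- An arithmetical formulation of PAC learnability of the class represented by `e`: for all `q ≥ 1`
there is a sample size `m`, such that for each `N` some learner with a program `c` is good enough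
for all distributions on points with inputs smaller than `N`. As only finitely many samples are
relevant for each `N`, it does not matter that the learner is computable here. -/
def PACCondition (e : ℕ) : Prop :=
  ∀ q, 1 ≤ q → ∃ m, ∀ N, ∃ c, (∀ S : Sample, ∃ k, k ∈ phi c (Encodable.encode S) ∧ k ∈ W e) ∧
    ∀ T : List (ℕ × Bool), T ≠ [] → (∀ p ∈ T, p.1 < N) → RarelyFails e c q q m T

theorem PACLearnable.pacCondition {e : ℕ} (he : IsRERIndex e) (h : PACLearnable (hypClass e)) :
    PACCondition e := by
  obtain ⟨s, A, hA, h⟩ := h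
  have hH : (hypClass e).Nonempty := ⟨_, hA []⟩
  choose k hk hkA using hA
  intro q hq
  -- accuracy and confidence `1 / (q + 1)` make up for the difference between `<` and `≤`
  have hq' : (0 : ℝ) < q := by exact_mod_cast hq
  have hlt : (1 : ℝ) / (q + 1) < 1 / q := one_div_lt_one_div_of_lt hq' (by linarith)
  let ε : Set.Ioo (0 : ℝ) 1 := ⟨1 / (q + 1), by positivity, by
    rw [div_lt_one (by positivity)]; linarith⟩
  refine ⟨s ε ε, fun N => ?_⟩
  -- the learner is replaced by a computable one outside the finite set of relevant samples
  have hfin : {S : Sample | S.length = s ε ε ∧ ∀ p ∈ S, p ∈ pointsBelow N}.Finite := by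
    refine ((List.finite_length_eq (pointsBelow N) (s ε ε)).image
      (List.map Subtype.val)).subset ?_
    rintro S ⟨hS, hSN⟩
    exact ⟨S.attach.map fun p => ⟨p.1, hSN p.1 p.2⟩, by simpa using hS,
      by
        rw [List.map_map]
        exact List.attach_map_subtype_val S⟩
  obtain ⟨B, hB⟩ := (hfin.image Encodable.encode).bddAbove
  let l : List ℕ := (List.range (B + 1)).map fun n =>
    k ((Encodable.decode (α := Sample) n).getD [])
  have hl : Computable fun S : Sample => (l[Encodable.encode S]?).getD (k []) :=
    Computable.option_getD (by fun_prop) (by fun_prop)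
  obtain ⟨c, hc⟩ := exists_forall_mem_phi hl
  refine ⟨c, fun S => ⟨_, hc S, ?_⟩, fun T hT hTN => ?_⟩
  · cases hi : l[Encodable.encode S]? with
    | none => exact hk []
    | some j =>
      obtain ⟨n, -, rfl⟩ := List.mem_map.1 (List.mem_of_getElem? hi)
      exact hk _
  · refine (he.rarelyFails_iff (A := A) hH hq hq hT fun S hS hST => ⟨_, hc S, ?_⟩).2 ?_
    · have hSB : Encodable.encode S ≤ B :=
        hB ⟨S, ⟨hS, fun p hp => mem_pointsBelow.2 (hTN p (hST p hp))⟩, rfl⟩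
      have : l[Encodable.encode S]? = some (k S) := by
        simp only [l, List.getElem?_map, List.getElem?_range (Nat.lt_succ_of_le hSB)]
        simp
      rw [this]
      exact hkA S
    · have := isProbabilityMeasure_listMeasure hT
      have h1 := h ε ε _ le_rfl (listMeasure T) this
      have h2 : sampleProb (listMeasure T) (s ε ε)
          (failureEvent (listMeasure T) (hypClass e) A ε) ≤ ε := by
        rw [sampleProb_risk_le] at h1
        linarith
      refine lt_of_le_of_lt ((sampleProb_mono fun S hS _ => ?_).trans h2) hlt
      exact lt_of_le_of_lt (add_le_add_right hlt.le _) hS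

/-- A sample of size `m + r` consists of two independent samples of sizes `m` and `r`. -/
theorem sampleProb_add (D : Measure (ℕ × Bool)) [IsProbabilityMeasure D] (m r : ℕ)
    (E : Set Sample) : sampleProb D (m + r) E =
      ((Measure.pi fun _ : Fin m => D).prod (Measure.pi fun _ : Fin r => D)).real
        {x | List.ofFn x.1 ++ List.ofFn x.2 ∈ E} := by
  have hmap : Measure.map (fun x : (Fin m → ℕ × Bool) × (Fin r → ℕ × Bool) => Fin.append x.1 x.2)
      ((Measure.pi fun _ : Fin m => D).prod (Measure.pi fun _ : Fin r => D)) =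
      Measure.pi fun _ : Fin (m + r) => D := by
    refine Measure.ext_of_singleton fun S => ?_
    rw [Measure.map_apply (by fun_prop) (measurableSet_singleton S), Measure.pi_singleton,
      Fin.prod_univ_add]
    have : (fun x : (Fin m → ℕ × Bool) × (Fin r → ℕ × Bool) => Fin.append x.1 x.2) ⁻¹' {S} =
        {fun i => S (Fin.castAdd r i)} ×ˢ {fun i => S (Fin.natAdd m i)} := by
      ext ⟨x, y⟩
      simp only [Set.mem_preimage, Set.mem_singleton_iff, Set.mem_prod]
      constructor
      · rintro rfl
        simp
      · rintro ⟨rfl, rfl⟩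
        exact Fin.append_castAdd_natAdd
    rw [this, Measure.prod_prod, Measure.pi_singleton, Measure.pi_singleton]
  rw [sampleProb, ← hmap, measureReal_def, measureReal_def,
    Measure.map_apply (by fun_prop) (Set.to_countable _).measurableSet]
  simp only [Set.preimage_ofPred_eq, List.ofFn_fin_append]

/-- If the second part of a sample is outside `G`, the first part is still random: the bound `δ` for
each fixed second part is a bound for the whole sample. -/
theorem sampleProb_add_le (D : Measure (ℕ × Bool)) [IsProbabilityMeasure D] {m r : ℕ}
    {E G : Set Sample} {δ δ' : ℝ} (hδ : 0 ≤ δ) (hG : sampleProb D r G ≤ δ')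
    (hE : ∀ S' ∉ G, S'.length = r → sampleProb D m {S | S ++ S' ∈ E} ≤ δ) :
    sampleProb D (m + r) E ≤ δ + δ' := by
  let μ := Measure.pi fun _ : Fin m => D
  let ν := Measure.pi fun _ : Fin r => D
  let E' : Set ((Fin m → ℕ × Bool) × (Fin r → ℕ × Bool)) :=
    {x | List.ofFn x.2 ∉ G ∧ List.ofFn x.1 ++ List.ofFn x.2 ∈ E}
  have h1 : (μ.prod ν).real E' ≤ δ := by
    refine ENNReal.toReal_le_of_le_ofReal hδ ?_
    rw [Measure.prod_apply_symm (Set.to_countable _).measurableSet]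
    calc _ ≤ ∫⁻ _, ENNReal.ofReal δ ∂ν := by
          refine lintegral_mono fun y => ?_
          by_cases hy : List.ofFn y ∈ G
          · have : (fun x => (x, y)) ⁻¹' E' = ∅ := by
              ext x
              simp [E', hy]
            simp [this]
          · refine ENNReal.le_ofReal_iff_toReal_le (measure_ne_top _ _) hδ |>.2 ?_
            refine le_trans ?_ (hE _ hy (by simp))
            exact measureReal_mono fun x hx => hx.2
      _ = ENNReal.ofReal δ := by simp
  have h2 : (μ.prod ν).real (Set.univ ×ˢ {y | List.ofFn y ∈ G}) ≤ δ' := by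
    rw [measureReal_prod_prod, probReal_univ, one_mul]
    exact hG
  rw [sampleProb_add]
  calc _ ≤ (μ.prod ν).real (E' ∪ Set.univ ×ˢ {y | List.ofFn y ∈ G}) := by
        refine measureReal_mono fun x hx => ?_
        by_cases hG : List.ofFn x.2 ∈ G
        · exact .inr ⟨trivial, hG⟩
        · exact .inl ⟨hG, hx⟩
    _ ≤ δ + δ' := (measureReal_union_le _ _).trans (add_le_add h1 h2)

/-- A strict upper bound for the inputs in a sample. -/
def inputBound : Sample → ℕ
  | [] => 0
  | p :: S => max (p.1 + 1) (inputBound S)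

theorem lt_inputBound {S : Sample} {p : ℕ × Bool} (hp : p ∈ S) : p.1 < inputBound S := by
  induction S with
  | nil => simp at hp
  | cons q S ih =>
    rcases List.mem_cons.1 hp with rfl | hp
    · exact lt_of_lt_of_le (Nat.lt_succ_self _) (le_max_left _ _)
    · exact lt_of_lt_of_le (ih hp) (le_max_right _ _)

/-- Whatever the distribution is, inputs beyond those in a large sample are improbable. -/
theorem sampleProb_tail_le (D : Measure (ℕ × Bool)) [IsProbabilityMeasure D] {η : ℝ} (hη : 0 < η)
    (hη1 : η < 1) (r : ℕ) :
    sampleProb D r {S | η < D.real {p | inputBound S ≤ p.1}} ≤ (1 - η) ^ r := by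
  classical
  have hex := exists_real_tail_le D hη
  have hanti : ∀ {M N : ℕ}, M ≤ N → D.real {p | N ≤ p.1} ≤ D.real {p | M ≤ p.1} :=
    fun h => measureReal_mono fun p hp => le_trans h hp
  have hspec := Nat.find_spec hex
  -- a sample with a bound that is too small consists of inputs below the `η`-quantile `N`
  have hbad : ∀ S, η < D.real {p | inputBound S ≤ p.1} → inputBound S < Nat.find hex :=
    fun S hS => by
      by_contra hlt
      exact absurd (hS.trans_le ((hanti (not_lt.1 hlt)).trans hspec)) (lt_irrefl _)
  cases hN : Nat.find hex with
  | zero =>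
    have : {S | η < D.real {p : ℕ × Bool | inputBound S ≤ p.1}} = ∅ := by
      ext S
      simp only [Set.mem_ofPred_eq, Set.mem_empty_iff_false, iff_false]
      intro hS
      have := hbad S hS
      omega
    rw [this]
    have h0 : sampleProb D r ∅ = 0 := by simp [sampleProb]
    rw [h0]
    exact pow_nonneg (by linarith) r
  | succ N =>
    have hmin : η < D.real {p | N ≤ p.1} := not_le.1 (Nat.find_min hex (by omega))
    calc _ ≤ (Measure.pi fun _ : Fin r => D).real (Set.univ.pi fun _ => {p | N ≤ p.1}ᶜ) := by
          refine measureReal_mono fun S hS i _ => ?_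
          have h1 := hbad _ hS
          have h2 : (S i).1 < inputBound (List.ofFn S) := lt_inputBound (List.mem_ofFn.2 ⟨i, rfl⟩)
          simp only [Set.mem_compl_iff, Set.mem_ofPred_eq]
          omega
      _ = (1 - D.real {p | N ≤ p.1}) ^ r := by
          rw [measureReal_def, Measure.pi_pi, ENNReal.toReal_prod]
          simp only [← measureReal_def]
          rw [probReal_compl_eq_one_sub (Set.to_countable _).measurableSet]
          simp
      _ ≤ (1 - η) ^ r := by
          have : D.real {p | N ≤ p.1} ≤ 1 := measureReal_le_one
          gcongr

/-- The learner uses the first part of a sample to choose a hypothesis, and the rest of it to bound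
the inputs that need to be considered. The accuracy is as good as the sample size permits. -/
theorem PACCondition.pacLearnable {e : ℕ} (he : IsRERIndex e) (h : PACCondition e) :
    PACLearnable (hypClass e) := by
  have h' : ∀ q, _ := fun q => h (q + 1) (Nat.succ_pos q)
  choose m c hc hT using h'
  choose k hk hkW using hc
  choose g hg using fun q N S => he (k q N S) (hkW q N S)
  have hmem : ∀ q N S, g q N S ∈ hypClass e := fun q N S => ⟨_, hkW q N S, hg q N S⟩
  have hH : (hypClass e).Nonempty := ⟨_, hmem 0 0 []⟩
  have hpos : ∀ q : ℕ, (0 : ℝ) < 1 / (q + 1) := fun q => by positivity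
  choose η hη0 hη1 hη4 hηm using fun q => exists_small 4 (m q) (hpos q)
  choose r hr using fun q =>
    exists_pow_lt_of_lt_one (hpos q) (show 1 - η q < 1 by linarith [hη0 q])
  let M : ℕ → ℕ := fun q => max q (m q + r q)
  -- samples of size `n` permit the accuracy and confidence `3 / (acc n + 1)`
  let acc : ℕ → ℕ := fun n => Nat.findGreatest (fun q => M q ≤ n) n
  let A : Sample → Hypothesis := fun S =>
    g (acc S.length) (inputBound (S.drop (m (acc S.length)))) (S.take (m (acc S.length)))
  -- the learner for inputs below `N`
  have hfail : ∀ q N (D : Measure (ℕ × Bool)), IsProbabilityMeasure D →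
      D.real {p | N ≤ p.1} ≤ η q →
      sampleProb D (m q) (failureEvent D (hypClass e) (g q N) (2 / (q + 1))) ≤ 2 / (q + 1) := by
    intro q N D hD hN
    have h4 : 4 * η q ≤ 1 / (q + 1) := by exact_mod_cast hη4 q
    have key := sampleProb_failureEvent_le D hH (g q N) (pointsBelow N) (ε := 2 / (q + 1))
      (ε' := 1 / (q + 1 : ℕ)) (δ := 1 / (q + 1 : ℕ)) (m := m q)
      (by rwa [compl_pointsBelow]) (hη0 q) (hη1 q) (by push_cast; field_simp at h4 ⊢; linarith)
      fun T hT' hTN => ((he.rarelyFails_iff hH (Nat.succ_pos q) (Nat.succ_pos q) hT'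
        fun S _ _ => ⟨k q N S, hk q N S, hg q N S⟩).1
          (hT q N T hT' fun p hp => mem_pointsBelow.1 (hTN p hp))).le
    refine key.trans ?_
    have h5 := (hηm q).le
    push_cast
    calc _ ≤ 1 / ((q : ℝ) + 1) + 1 / (q + 1) := by linarith
      _ = 2 / (q + 1) := by ring
  -- the combined learner
  have hA : ∀ n q, acc n = q → M q ≤ n → ∀ D : Measure (ℕ × Bool), IsProbabilityMeasure D →
      sampleProb D n (failureEvent D (hypClass e) A (2 / (q + 1))) ≤ 3 / (q + 1) := by
    intro n q hq hM D hD
    obtain ⟨l, rfl⟩ := Nat.exists_eq_add_of_le ((le_max_right q (m q + r q)).trans hM)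
    rw [add_assoc] at hq ⊢
    have htail : sampleProb D (r q + l) {S | η q < D.real {p | inputBound S ≤ p.1}} ≤
        1 / (q + 1) :=
      (sampleProb_tail_le D (hη0 q) (hη1 q) _).trans
        ((pow_le_pow_of_le_one (by linarith [hη1 q]) (by linarith [hη0 q])
          (Nat.le_add_right _ _)).trans (hr q).le)
    refine (sampleProb_add_le D (δ := 2 / (q + 1)) (by positivity) htail
      fun S' hS' hlen' => ?_).trans (le_of_eq (by ring))
    refine (sampleProb_mono fun S hS hlen => ?_).trans
      (hfail q (inputBound S') D hD (not_lt.1 hS'))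
    have hAS : A (S ++ S') = g q (inputBound S') S := by
      have : acc (S ++ S').length = q := by rw [List.length_append, hlen, hlen', hq]
      simp only [A, this]
      rw [← hlen, List.drop_left, List.take_left]
    have hS1 : bestRisk D (hypClass e) + 2 / (q + 1) < risk D (A (S ++ S')) := hS
    rw [hAS] at hS1
    exact hS1
  -- accuracy and confidence for a given sample size
  have hacc : ∀ q n, M q ≤ n → q ≤ acc n ∧ M (acc n) ≤ n := fun q n hn =>
    have hqn : q ≤ n := (le_max_left _ _).trans hn
    ⟨Nat.le_findGreatest hqn hn, Nat.findGreatest_spec (P := fun q => M q ≤ n) hqn hn⟩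
  choose s hs using fun ε : Set.Ioo (0 : ℝ) 1 => exists_nat_gt (3 / (ε : ℝ))
  have hs' : ∀ (ε : Set.Ioo (0 : ℝ) 1) (q : ℕ), s ε ≤ q → 3 / ((q : ℝ) + 1) ≤ ε := by
    intro ε q hq
    have h1 : (s ε : ℝ) ≤ q := by exact_mod_cast hq
    have h2 := (div_lt_iff₀ ε.2.1).1 (hs ε)
    rw [div_le_iff₀ (by positivity)]
    nlinarith [ε.2.1]
  refine ⟨fun ε δ => M (max (s ε) (s δ)), A, fun S => hmem _ _ _, fun ε δ n hn D hD => ?_⟩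
  obtain ⟨h1, h2⟩ := hacc _ _ hn
  have h3 := hA n _ rfl h2 D hD
  have h4 := hs' ε _ ((le_max_left _ _).trans h1)
  have h5 := hs' δ _ ((le_max_right _ _).trans h1)
  have h6 : 2 / ((acc n : ℝ) + 1) ≤ 3 / (acc n + 1) := by gcongr; norm_num
  rw [sampleProb_risk_le]
  have h7 : sampleProb D n (failureEvent D (hypClass e) A ε) ≤
      sampleProb D n (failureEvent D (hypClass e) A (2 / (acc n + 1))) :=
    sampleProb_mono fun S hS _ =>
      lt_of_le_of_lt (add_le_add_right (h6.trans h4) (bestRisk D (hypClass e))) hS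
  linarith

/-! ### The conditions are arithmetical -/

section

variable {α β : Type} [Primcodable α] [Primcodable β]

theorem Arithmetical.mem_phi {f g h : α → ℕ} (hf : Computable f) (hg : Computable g)
    (hh : Computable h) : Arithmetical fun a => h a ∈ phi (f a) (g a) :=
  (Arithmetical.mem_partrec partrec_phi).comp (f := fun a => ((f a, g a), h a)) (by fun_prop)

theorem Arithmetical.mem_W {f g : α → ℕ} (hf : Computable f) (hg : Computable g) :
    Arithmetical fun a => g a ∈ W (f a) := by
  refine (Arithmetical.ex (P := fun a y => y ∈ phi (f a) (g a))
    (Arithmetical.mem_phi (hf.comp Computable.fst) (hg.comp Computable.fst)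
      Computable.snd)).of_iff fun a => ?_
  exact Part.dom_iff_mem

theorem Arithmetical.lt {f g : α → ℕ} (hf : Computable f) (hg : Computable g) :
    Arithmetical fun a => f a < g a :=
  (Arithmetical.of_computable (hf.decide_lt hg)).of_iff fun a => by simp

theorem Arithmetical.le {f g : α → ℕ} (hf : Computable f) (hg : Computable g) :
    Arithmetical fun a => f a ≤ g a :=
  (Arithmetical.lt hg hf).not.of_iff fun a => by simp

theorem Arithmetical.eq {f g : α → β} (hf : Computable f) (hg : Computable g) :
    Arithmetical fun a => f a = g a := by
  classical
  exact (Arithmetical.of_computable (hf.decide_eq hg)).of_iff fun a => by simp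

theorem Arithmetical.ball_list {P : α → β → Prop} {l : α → List β}
    (hP : Arithmetical fun p : α × β => P p.1 p.2) (hl : Computable l) :
    Arithmetical fun a => ∀ b ∈ l a, P a b := by
  have h : Arithmetical fun a => ∀ b, ∀ i : ℕ, (l a)[i]? = some b → P a b := by
    refine .all (.all (.imp (.eq ?_ (by fun_prop)) (hP.comp Computable.fst)))
    exact Computable.getElem?' (hl.comp (Computable.fst.comp Computable.fst)) Computable.snd
  refine h.of_iff fun a => ?_
  simp [List.mem_iff_getElem?]

theorem Arithmetical.nodup : Arithmetical fun l : List α => l.Nodup := by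
  have h : Arithmetical fun l : List α => ∀ i j : ℕ, i < j → j < l.length → ¬ l[i]? = l[j]? :=
    .all (.all (.imp (.lt (by fun_prop) (by fun_prop)) (.imp (.lt (by fun_prop) (by fun_prop))
      (.not (.eq (by fun_prop) (by fun_prop))))))
  exact h.of_iff fun l => List.nodup_iff_getElem?_ne_getElem?

@[fun_prop]
theorem Computable.natPow {f g : α → ℕ} (hf : Computable f) (hg : Computable g) :
    Computable fun a => f a ^ g a := by
  have : Primrec₂ fun m n : ℕ => m ^ n := Primrec₂.unpaired'.1 Nat.Primrec.pow
  exact this.to_comp.comp hf hg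

theorem primrec_errCount : Primrec fun x : (List (ℕ × Bool) × ℕ) × ℕ =>
    errCount x.1.1 x.1.2 x.2 := by
  have hcode : Primrec fun y : ((List (ℕ × Bool) × ℕ) × ℕ) × ℕ × ℕ × Bool =>
      Nat.Partrec.Code.evaln y.1.2 (Denumerable.ofNat Nat.Partrec.Code y.1.1.2) y.2.2.1 :=
    Nat.Partrec.Code.primrec_evaln.comp (((Primrec.snd.comp Primrec.fst).pair
      ((Primrec.ofNat _).comp (Primrec.snd.comp (Primrec.fst.comp Primrec.fst)))).pair
      (Primrec.fst.comp (Primrec.snd.comp Primrec.snd)))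
  have hlabel : Primrec fun y : ((List (ℕ × Bool) × ℕ) × ℕ) × ℕ × ℕ × Bool =>
      some y.2.2.2.toNat :=
    Primrec.option_some.comp ((Primrec.dom_finite Bool.toNat).comp
      (Primrec.snd.comp (Primrec.snd.comp Primrec.snd)))
  have hstep : Primrec fun y : ((List (ℕ × Bool) × ℕ) × ℕ) × ℕ × ℕ × Bool =>
      if Nat.Partrec.Code.evaln y.1.2 (Denumerable.ofNat Nat.Partrec.Code y.1.1.2) y.2.2.1 =
        some y.2.2.2.toNat then y.2.1 else y.2.1 + 1 :=
    Primrec.ite (Primrec.eq.comp hcode hlabel) (Primrec.fst.comp Primrec.snd)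
      (Primrec.succ.comp (Primrec.fst.comp Primrec.snd))
  refine (Primrec.list_foldl (Primrec.fst.comp Primrec.fst) (Primrec.const 0)
    hstep.to₂).of_eq fun x => ?_
  obtain ⟨⟨T, k⟩, s⟩ := x
  have : ∀ n : ℕ, List.foldl (fun (n : ℕ) (p : ℕ × Bool) =>
      if Nat.Partrec.Code.evaln s (Denumerable.ofNat Nat.Partrec.Code k) p.1 = some p.2.toNat
        then n else n + 1) n T = n + errCount T k s := by
    induction T with
    | nil => simp [errCount]
    | cons p T ih =>
      intro n
      simp only [errCount, List.foldl_cons, List.countP_cons] at ih ⊢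
      rw [ih]
      split_ifs <;> simp_all
      omega
  simpa using this 0

@[fun_prop]
theorem Computable.errCount' {f : α → List (ℕ × Bool)} {g h : α → ℕ} (hf : Computable f)
    (hg : Computable g) (hh : Computable h) : Computable fun a => errCount (f a) (g a) (h a) :=
  primrec_errCount.to_comp.comp ((hf.pair hg).pair hh)

theorem Arithmetical.failsOn : Arithmetical fun x : (ℕ × ℕ × ℕ) × List (ℕ × Bool) × Sample =>
    FailsOn x.1.1 x.1.2.1 x.1.2.2 x.2.1 x.2.2 := by
  unfold FailsOn Worse
  refine .ex (.and (.mem_phi (by fun_prop) (by fun_prop) (by fun_prop)) (.ex (.and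
    (.mem_W (by fun_prop) (by fun_prop)) (.ex (.all (.lt (by fun_prop) (by fun_prop)))))))

@[fun_prop]
theorem Computable.map_getD {T : α → List (ℕ × Bool)} {u : α → List ℕ} (hT : Computable T)
    (hu : Computable u) : Computable fun a => (u a).map fun j => (T a).getD j (0, false) := by
  have h : Primrec fun x : List (ℕ × Bool) × List ℕ => x.2.map fun j => x.1.getD j (0, false) :=
    Primrec.list_map Primrec.snd ((Primrec.list_getD (0, false)).comp
      (Primrec.fst.comp Primrec.fst) Primrec.snd).to₂
  exact h.to_comp.comp (hT.pair hu)

theorem Arithmetical.rarelyFails :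
    Arithmetical fun x : (ℕ × ℕ × ℕ) × (ℕ × ℕ) × List (ℕ × Bool) =>
      RarelyFails x.1.1 x.1.2.1 x.1.2.2 x.2.1.1 x.2.1.2 x.2.2 := by
  unfold RarelyFails
  refine .all (.imp (Arithmetical.nodup.comp Computable.snd) (.imp (.ball_list (.and (.and
    (.eq (by fun_prop) (by fun_prop)) (.ball_list (.lt (by fun_prop) (by fun_prop))
      Computable.snd)) ?_) Computable.snd) (.lt (by fun_prop) (by fun_prop))))
  exact Arithmetical.failsOn.comp (f := fun y : (((ℕ × ℕ × ℕ) × (ℕ × ℕ) × List (ℕ × Bool)) ×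
    List (List ℕ)) × List ℕ => (y.1.1.1, y.1.1.2.2,
      y.2.map fun j => y.1.1.2.2.getD j (0, false))) (by fun_prop)

end

theorem arithmetical_scpacCondition : Arithmetical SCPACCondition := by
  unfold SCPACCondition
  refine .ex (.ex (.and ?_ (.and ?_ ?_)))
  · exact .all (.all (.ex (.mem_phi (by fun_prop) (by fun_prop) (by fun_prop))))
  · exact .all (.ex (.and (.mem_phi (by fun_prop) (by fun_prop) (by fun_prop))
      (.ex (.and (.mem_W (by fun_prop) (by fun_prop))
        (.all (.ex (.and (.mem_phi (by fun_prop) (by fun_prop) (by fun_prop))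
          (.mem_phi (by fun_prop) (by fun_prop) (by fun_prop)))))))))
  · refine .all (.all (.all (.all (.imp (.le (by fun_prop) (by fun_prop))
      (.imp (.le (by fun_prop) (by fun_prop))
      (.imp (.mem_phi (by fun_prop) (by fun_prop) (by fun_prop))
      (.imp (.le (by fun_prop) (by fun_prop))
      (.all (.imp (.not (.eq (by fun_prop) (by fun_prop))) ?_)))))))))
    exact Arithmetical.rarelyFails.comp (f := fun y : ((((((ℕ × ℕ) × ℕ) × ℕ) × ℕ) × ℕ) × ℕ) ×
      List (ℕ × Bool) => ((y.1.1.1.1.1.1.1, y.1.1.1.1.1.2, y.1.1.1.1.2),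
        (y.1.1.1.2, y.1.1.2), y.2)) (by fun_prop)

theorem arithmetical_pacCondition : Arithmetical PACCondition := by
  unfold PACCondition
  refine .all (.imp (.le (by fun_prop) (by fun_prop)) (.ex (.all (.ex (.and ?_ (.all
    (.imp (.not (.eq (by fun_prop) (by fun_prop)))
      (.imp (.ball_list (.lt (by fun_prop) (by fun_prop)) (by fun_prop)) ?_))))))))
  · exact .all (.ex (.and (.mem_phi (by fun_prop) (by fun_prop) (by fun_prop))
      (.mem_W (by fun_prop) (by fun_prop))))
  · exact Arithmetical.rarelyFails.comp (f := fun y : ((((ℕ × ℕ) × ℕ) × ℕ) × ℕ) ×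
      List (ℕ × Bool) => ((y.1.1.1.1.1, y.1.2, y.1.1.1.1.2), (y.1.1.1.1.2, y.1.1.1.2), y.2))
      (by fun_prop)

theorem proposition4p2 :
    -- PAC and SCPAC learnability can be arithmetically characterized
    (ArithmeticallyCharacterizable PACLearnable ∧ ArithmeticallyCharacterizable SCPACLearnable) ∧
    -- maximal families are computable families
    (∀ H : ℕ → Set Hypothesis, IsMaximalFamily H → IsComputableFamily H) ∧
    -- for a characterized notion `L` and a computable family `H`
    ∀ (L : Set Hypothesis → Prop) (ψ : ArithFormula), Characterizes ψ L →
      ∀ (H : ℕ → Set Hypothesis) (r : ℕ → ℕ), RepresentsFamily r H →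
        -- the characterization yields arithmetical statements that the `H i` are learnable
        ExpressesLearnability L H (fun i => ψ.atNumeral (r i)) ∧
        -- the decision problem is unsolvable for nontrivial maximal families
        (IsMaximalFamily H → (∃ i, L (H i)) → (∃ i, ¬ L (H i)) → ¬ LearnabilitySolvable L H) ∧
        -- unsolvability yields independence for infinitely many `i`
        (ZFCArithmeticallySound → ¬ LearnabilitySolvable L H →
          ∀ Y : ℕ → ArithFormula, ExpressesLearnability L H Y →
            {i | IndependentOfZFC (Y i)}.Infinite) :=
  ⟨⟨arithmetical_pacCondition.arithmeticallyCharacterizable fun _ he =>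
      ⟨fun h => h.pacLearnable he, fun h => h.pacCondition he⟩,
    arithmetical_scpacCondition.arithmeticallyCharacterizable fun _ he =>
      ⟨fun h => h.scpacLearnable he, fun h => h.scpacCondition he⟩⟩,
    fun _ hH => hH.isComputableFamily, fun _ _ hψ _ _ hr =>
      ⟨hψ.expressesLearnability hr, fun hH h h' => hH.not_learnabilitySolvable h h',
        fun hZ hL _ hY => hY.infinite_independent hZ hL⟩⟩
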